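/- Let $\mathbb{B}=\{q\in\mathbb{H}:|q|<1\}$ be the open unit ball of the quaternions, $\mathrm{Sp}(1)=\{u\in\mathbb{H}:|u|=1\}$, and $\mathrm{Sp}(1,1)=\{A\in M_2(\mathbb{H}): A^*I_{1,1}A=I_{1,1}\}$ with $I_{1,1}=\mathrm{diag}(1,-1)$, a Lie group embedded in $M_2(\mathbb{H})$. For functions on $\mathbb{B}$ with power series expansions $f(q)=\sum_n q^na_n$, $g(q)=\sum_n q^nb_n$ put $(f*g)(q)=\sum_n q^n\sum_{k=0}^n a_kb_{n-k}$, $f^c(q)=\sum_n q^n\overline{a_n}$, $f^s=f*f^c$ and $f^{-*}=\frac{1}{f^s}f^c$. For $A=\begin{pmatrix}a&c\\ b&d\end{pmatrix}\in\mathrm{Sp}(1,1)$ let $\mathcal{F}_A:\mathbb{B}\to\mathbb{B}$, $\mathcal{F}_A(q)=(qc+d)^{-*}*(qa+b)$, be the associated slice regular Möbius transformation; it is a bijection of $\mathbb{B}$. Let $\mathcal{M}(\mathbb{B})=\{\mathcal{F}_A:A\in\mathrm{Sp}(1,1)\}$, with the ($7$-dimensional, $C^\infty$) manifold structure for which $\mathrm{Sp}(1,1)\to\mathcal{M}(\mathbb{B})$,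 $A\mapsto\mathcal{F}_{A^{-1}}$, is a submersion (equivalently, for which the induced bijection $\mathrm{Sp}(1,1)/\mathrm{Sp}(1)I_2\to\mathcal{M}(\mathbb{B})$ is a diffeomorphism); such a structure exists. Let $\mathcal{M}(\mathbb{B})_0=\{\mathcal{F}\in\mathcal{M}(\mathbb{B}):\mathcal{F}(0)=0\}$. Then, for every such structure, $\mathcal{M}(\mathbb{B})_0$ is an embedded submanifold of $\mathcal{M}(\mathbb{B})$ and, with the composition of maps, a Lie group, and $u\mapsto(q\mapsto qu^{-1})$ is an isomorphism of Lie groups $\mathrm{Sp}(1)\to\mathcal{M}(\mathbb{B})_0$. The inverse orbit map $\mathcal{M}(\mathbb{B})\to\mathbb{B}$, $\mathcal{F}\mapsto\mathcal{F}^{-1}(0)$, is a globally trivial principal fiber bundle with structure group $\mathcal{M}(\mathbb{B})_0$ acting on the left by $(\mathcal{F}_0,\mathcal{F})\mapsto\mathcal{F}_0\circ\mathcal{F}$. That is: the map is a surjective submersion; the action is smooth, free and proper and its orbits are exactly the fibers of the map; the bundle is locally trivial; and there is a diffeomorphism $\Phi:\mathbb{B}\times\mathcal{M}(\mathbb{B})_0\to\mathcal{M}(\mathbb{B})$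 with $\Phi(x,\mathcal{G}\circ\mathcal{F}_0)=\mathcal{G}\circ\Phi(x,\mathcal{F}_0)$ and $\Phi(x,\mathcal{F}_0)^{-1}(0)=x$ for all $x\in\mathbb{B}$ and $\mathcal{F}_0,\mathcal{G}\in\mathcal{M}(\mathbb{B})_0$. -/

import Mathlib

open scoped Quaternion Matrix Manifold ContDiff

attribute [local instance] Matrix.linftyOpNormedRing Matrix.linftyOpNormedAlgebra

noncomputable section

/-! ### The Lie group `Sp(1,1)` -/

/-- The algebra `M₂(ℍ)`. -/
abbrev QMat : Type := Matrix (Fin 2) (Fin 2) ℍ[ℝ]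

/-- The topology of the normed algebra `M₂(ℍ)`; it is the product topology on the entries. -/
instance : TopologicalSpace QMat :=
  (inferInstance : NormedRing QMat).toSeminormedRing.toPseudoMetricSpace.toUniformSpace.toTopologicalSpace

/-- The matrix `I_{1,1} = diag(1, -1)`. -/
def I11 : QMat := !![1, 0; 0, -1]

theorem I11_mul_self : I11 * I11 = 1 := by
  refine Matrix.ext fun i j => ?_
  fin_cases i <;> fin_cases j <;> simp [I11, Matrix.mul_apply]

theorem I11_conjTranspose : I11ᴴ = I11 := by
  refine Matrix.ext fun i j => ?_
  fin_cases i <;> fin_cases j <;> simp [I11, Matrix.conjTranspose_apply]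

theorem I11_mul_cancel (X : QMat) : I11 * (I11 * X) = X := by
  rw [← mul_assoc, I11_mul_self, one_mul]

/-- `Sp(1,1) = {A ∈ M₂(ℍ) : A* I_{1,1} A = I_{1,1}}`, with the product of matrices. -/
def Sp11 : Submonoid QMat where
  carrier := {A | Aᴴ * I11 * A = I11}
  one_mem' := by simp
  mul_mem' := by
    intro A B hA hB
    simp only [Set.mem_ofPred_eq] at *
    calc (A * B)ᴴ * I11 * (A * B) = Bᴴ * (Aᴴ * I11 * A) * B := by
          rw [Matrix.conjTranspose_mul]; simp only [mul_assoc]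
      _ = I11 := by rw [hA, hB]

theorem Sp11.conj_mul_mul (A : Sp11) : (A : QMat)ᴴ * I11 * (A : QMat) = I11 := A.2

theorem Sp11.mul_mul_conj (A : Sp11) : (A : QMat) * I11 * (A : QMat)ᴴ = I11 := by
  have h : (I11 * (A : QMat)ᴴ * I11) * (A : QMat) = 1 := by
    rw [mul_assoc, mul_assoc, ← mul_assoc (A : QMat)ᴴ, Sp11.conj_mul_mul, I11_mul_self]
  have h2 := mul_eq_one_comm.1 h
  calc (A : QMat) * I11 * (A : QMat)ᴴ
      = ((A : QMat) * (I11 * (A : QMat)ᴴ * I11)) * I11 := by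
        simp only [mul_assoc, I11_mul_self, mul_one]
    _ = I11 := by rw [h2, one_mul]

instance : Inv Sp11 where
  inv A := ⟨I11 * (A : QMat)ᴴ * I11, by
    change (I11 * (A : QMat)ᴴ * I11)ᴴ * I11 * (I11 * (A : QMat)ᴴ * I11) = I11
    calc _ = I11 * ((A : QMat) * (I11 * I11) * I11 * (A : QMat)ᴴ) * I11 := by
          simp only [Matrix.conjTranspose_mul, Matrix.conjTranspose_conjTranspose,
            I11_conjTranspose, mul_assoc, I11_mul_cancel]
      _ = I11 := by
          rw [I11_mul_self, mul_one, Sp11.mul_mul_conj, I11_mul_self, one_mul]⟩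

instance : Group Sp11 :=
  { Submonoid.toMonoid Sp11 with
    inv := Inv.inv
    inv_mul_cancel := fun A => Subtype.ext (by
      change I11 * (A : QMat)ᴴ * I11 * (A : QMat) = 1
      rw [mul_assoc, mul_assoc, ← mul_assoc (A : QMat)ᴴ, Sp11.conj_mul_mul, I11_mul_self]) }

theorem conjTranspose_real_smul (r : ℝ) (X : QMat) : (r • X)ᴴ = r • Xᴴ :=
  Matrix.ext fun i j => by simp [Matrix.conjTranspose_apply]

theorem isUnit_two_smul {X : QMat} (h : IsUnit X) : IsUnit ((2 : ℝ) • X) := by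
  have : IsUnit ((Units.mk0 (2 : ℝ) two_ne_zero) • X) := (isUnit_smul_iff _ _).2 h
  exact this

/-- The Lie algebra `𝔰𝔭(1,1) = {X ∈ M₂(ℍ) : X* I_{1,1} + I_{1,1} X = 0}`, the model space of the
manifold `Sp(1,1)`. -/
def sp11 : Submodule ℝ QMat where
  carrier := {X | Xᴴ * I11 + I11 * X = 0}
  zero_mem' := by simp
  add_mem' := by
    intro X Y hX hY
    simp only [Set.mem_ofPred_eq] at *
    calc (X + Y)ᴴ * I11 + I11 * (X + Y) = (Xᴴ * I11 + I11 * X) + (Yᴴ * I11 + I11 * Y) := by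
          rw [Matrix.conjTranspose_add, add_mul, mul_add]; abel
      _ = 0 := by rw [hX, hY, add_zero]
  smul_mem' := by
    intro r X hX
    simp only [Set.mem_ofPred_eq] at *
    have h : (r • X)ᴴ = r • Xᴴ := conjTranspose_real_smul r X
    rw [h, smul_mul_assoc, mul_smul_comm, ← smul_add, hX, smul_zero]

/-- The linear projection `X ↦ (X - I_{1,1} X* I_{1,1}) / 2` of `M₂(ℍ)` onto `𝔰𝔭(1,1)`. -/
def sp11Proj : QMat →L[ℝ] sp11 :=
  LinearMap.toContinuousLinearMap
    { toFun := fun X => ⟨(1 / 2 : ℝ) • (X - I11 * Xᴴ * I11), sp11.smul_mem _ (by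
        change (X - I11 * Xᴴ * I11)ᴴ * I11 + I11 * (X - I11 * Xᴴ * I11) = 0
        simp only [Matrix.conjTranspose_sub, Matrix.conjTranspose_mul,
          Matrix.conjTranspose_conjTranspose, I11_conjTranspose, sub_mul, mul_sub, mul_assoc,
          I11_mul_self, I11_mul_cancel, mul_one]
        abel)⟩
      map_add' := fun X Y => Subtype.ext (by
        change (1 / 2 : ℝ) • (X + Y - I11 * (X + Y)ᴴ * I11)
          = (1 / 2 : ℝ) • (X - I11 * Xᴴ * I11) + (1 / 2 : ℝ) • (Y - I11 * Yᴴ * I11)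
        rw [← smul_add, Matrix.conjTranspose_add, mul_add, add_mul]
        congr 1
        abel)
      map_smul' := fun r X => Subtype.ext (by
        change (1 / 2 : ℝ) • (r • X - I11 * (r • X)ᴴ * I11)
          = r • ((1 / 2 : ℝ) • (X - I11 * Xᴴ * I11))
        have h : (r • X)ᴴ = r • Xᴴ := conjTranspose_real_smul r X
        rw [h, mul_smul_comm, smul_mul_assoc, ← smul_sub, smul_comm]) }

theorem sp11Proj_coe (X : QMat) (hX : X ∈ sp11) : (sp11Proj X : QMat) = X := by
  have h : Xᴴ * I11 = -(I11 * X) := eq_neg_of_add_eq_zero_left hX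
  change (1 / 2 : ℝ) • (X - I11 * Xᴴ * I11) = X
  rw [mul_assoc, h, mul_neg, I11_mul_cancel, sub_neg_eq_add, ← two_smul ℝ X, smul_smul]
  norm_num

/-- The Cayley transform `X ↦ (1 - X)(1 + X)⁻¹`. -/
def cayley (X : QMat) : QMat := (1 - X) * Ring.inverse (1 + X)

theorem cayley_add_one {X : QMat} (h : IsUnit (1 + X)) :
    1 + cayley X = (2 : ℝ) • Ring.inverse (1 + X) := by
  calc 1 + cayley X = (1 + X) * Ring.inverse (1 + X) + (1 - X) * Ring.inverse (1 + X) := by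
        rw [Ring.mul_inverse_cancel _ h, cayley]
    _ = (2 : ℝ) • Ring.inverse (1 + X) := by
        rw [← add_mul, two_smul]; simp only [add_mul, sub_mul, one_mul]; abel

theorem isUnit_cayley_add_one {X : QMat} (h : IsUnit (1 + X)) : IsUnit (1 + cayley X) := by
  rw [cayley_add_one h]
  exact isUnit_two_smul h.ringInverse

theorem cayley_cayley {X : QMat} (h : IsUnit (1 + X)) : cayley (cayley X) = X := by
  have h1 : 1 - cayley X = X * (1 + cayley X) := by
    rw [cayley_add_one h]
    calc 1 - cayley X = (1 + X) * Ring.inverse (1 + X) - (1 - X) * Ring.inverse (1 + X) := by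
          rw [Ring.mul_inverse_cancel _ h, cayley]
      _ = X * (2 : ℝ) • Ring.inverse (1 + X) := by
          rw [← sub_mul, two_smul]; simp only [add_mul, sub_mul, one_mul, mul_add]; abel
  rw [cayley, h1, mul_assoc, Ring.mul_inverse_cancel _ (isUnit_cayley_add_one h), mul_one]

theorem cayley_mem_Sp11 {X : QMat} (hX : X ∈ sp11) (h : IsUnit (1 + X)) : cayley X ∈ Sp11 := by
  have h0 : Xᴴ * I11 = -(I11 * X) := eq_neg_of_add_eq_zero_left hX
  have h1 : (1 - X)ᴴ * I11 = I11 * (1 + X) := by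
    rw [Matrix.conjTranspose_sub, Matrix.conjTranspose_one, sub_mul, h0, mul_add]; simp
  have h2 : (1 + X)ᴴ * I11 = I11 * (1 - X) := by
    rw [Matrix.conjTranspose_add, Matrix.conjTranspose_one, add_mul, h0, mul_sub]; simp
    abel
  have h3 : (Ring.inverse (1 + X))ᴴ * (1 + X)ᴴ = 1 := by
    rw [← Matrix.conjTranspose_mul, Ring.mul_inverse_cancel _ h, Matrix.conjTranspose_one]
  have h4 : (1 + X) * (1 - X) = (1 - X) * (1 + X) := by
    simp only [mul_add, mul_sub, add_mul, sub_mul, mul_one, one_mul]; abel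
  change (cayley X)ᴴ * I11 * cayley X = I11
  calc (cayley X)ᴴ * I11 * cayley X
      = (Ring.inverse (1 + X))ᴴ * (((1 - X)ᴴ * I11) * (1 - X)) * Ring.inverse (1 + X) := by
        rw [cayley, Matrix.conjTranspose_mul]; simp only [mul_assoc]
    _ = (Ring.inverse (1 + X))ᴴ * ((1 + X)ᴴ * I11) * ((1 + X) * Ring.inverse (1 + X)) := by
        rw [h1, mul_assoc I11, h4, ← mul_assoc I11, ← h2]; simp only [mul_assoc]
    _ = I11 := by
        rw [Ring.mul_inverse_cancel _ h, mul_one, ← mul_assoc, h3, one_mul]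

theorem cayley_mem_sp11 {A : QMat} (hA : A ∈ Sp11) (h : IsUnit (1 + A)) : cayley A ∈ sp11 := by
  have h0 : Aᴴ * I11 * A = I11 := hA
  have h3 : (Ring.inverse (1 + A))ᴴ * (1 + A)ᴴ = 1 := by
    rw [← Matrix.conjTranspose_mul, Ring.mul_inverse_cancel _ h, Matrix.conjTranspose_one]
  have h5 : (1 - A)ᴴ * I11 * (1 + A) + (1 + A)ᴴ * I11 * (1 - A) = 0 := by
    simp only [Matrix.conjTranspose_sub, Matrix.conjTranspose_add, Matrix.conjTranspose_one,
      sub_mul, add_mul, mul_add, mul_sub, one_mul, mul_one, h0]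
    abel
  change (cayley A)ᴴ * I11 + I11 * cayley A = 0
  calc (cayley A)ᴴ * I11 + I11 * cayley A
      = (Ring.inverse (1 + A))ᴴ * ((1 - A)ᴴ * I11) * ((1 + A) * Ring.inverse (1 + A))
        + ((Ring.inverse (1 + A))ᴴ * (1 + A)ᴴ) * I11 * ((1 - A) * Ring.inverse (1 + A)) := by
        rw [h3, Ring.mul_inverse_cancel _ h, cayley, Matrix.conjTranspose_mul]
        simp only [mul_assoc, one_mul, mul_one]
    _ = (Ring.inverse (1 + A))ᴴ * ((1 - A)ᴴ * I11 * (1 + A) + (1 + A)ᴴ * I11 * (1 - A))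
        * Ring.inverse (1 + A) := by
        simp only [mul_add, add_mul, mul_assoc]
    _ = 0 := by rw [h5]; simp

theorem contDiffOn_cayley : ContDiffOn ℝ ∞ cayley {X | IsUnit (1 + X)} := by
  rintro X ⟨u, hu⟩
  have h1 : ContDiffAt ℝ ∞ Ring.inverse (1 + X) := hu ▸ contDiffAt_ringInverse ℝ u
  have h2 : ContDiffAt ℝ ∞ (fun Y : QMat => Ring.inverse (1 + Y)) X :=
    ContDiffAt.comp (f := fun Y : QMat => 1 + Y) X h1 (contDiffAt_const.add contDiffAt_id)
  exact ((contDiffAt_const.sub contDiffAt_id).mul h2).contDiffWithinAt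

theorem isOpen_isUnit_one_add : IsOpen {X : QMat | IsUnit (1 + X)} :=
  Units.isOpen.preimage (continuous_const.add continuous_id)

open Classical in
/-- The chart of `Sp(1,1)` at the identity given by the Cayley transform. -/
def Sp11.chartOne : OpenPartialHomeomorph Sp11 sp11 where
  toFun A := sp11Proj (cayley A)
  invFun X := if h : IsUnit (1 + (X : QMat)) then ⟨cayley X, cayley_mem_Sp11 X.2 h⟩ else 1
  source := {A | IsUnit (1 + (A : QMat))}
  target := {X | IsUnit (1 + (X : QMat))}
  map_source' := by
    intro A hA
    change IsUnit (1 + ((sp11Proj (cayley A) : sp11) : QMat))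
    rw [sp11Proj_coe _ (cayley_mem_sp11 A.2 hA)]
    exact isUnit_cayley_add_one hA
  map_target' := by
    intro X hX
    have hX' : IsUnit (1 + (X : QMat)) := hX
    rw [dif_pos hX']
    exact isUnit_cayley_add_one hX'
  left_inv' := by
    intro A hA
    have h1 := sp11Proj_coe _ (cayley_mem_sp11 A.2 hA)
    have h2 : IsUnit (1 + ((sp11Proj (cayley A) : sp11) : QMat)) := by
      rw [h1]; exact isUnit_cayley_add_one hA
    rw [dif_pos h2]
    apply Subtype.ext
    change cayley ((sp11Proj (cayley A) : sp11) : QMat) = A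
    rw [h1, cayley_cayley hA]
  right_inv' := by
    intro X hX
    have hX' : IsUnit (1 + (X : QMat)) := hX
    rw [dif_pos hX']
    apply Subtype.ext
    change ((sp11Proj (cayley (cayley X)) : sp11) : QMat) = X
    rw [cayley_cayley hX', sp11Proj_coe _ X.2]
  open_source := isOpen_isUnit_one_add.preimage continuous_subtype_val
  open_target := isOpen_isUnit_one_add.preimage continuous_subtype_val
  continuousOn_toFun := sp11Proj.continuous.comp_continuousOn
    (contDiffOn_cayley.continuousOn.comp continuous_subtype_val.continuousOn fun _ h => h)
  continuousOn_invFun := by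
    rw [Topology.IsInducing.subtypeVal.continuousOn_iff]
    refine ContinuousOn.congr (f := fun X : sp11 => cayley X)
      (contDiffOn_cayley.continuousOn.comp continuous_subtype_val.continuousOn fun _ h => h) ?_
    intro X hX
    have hX' : IsUnit (1 + (X : QMat)) := hX
    simp only [Function.comp_apply]
    rw [dif_pos hX']

/-- The chart of `Sp(1,1)` at `g`: the left translate `A ↦ (1 - g⁻¹A)(1 + g⁻¹A)⁻¹` of the chart
at the identity. -/
def Sp11.chart (g : Sp11) : OpenPartialHomeomorph Sp11 sp11 :=
  (Homeomorph.mulLeft g⁻¹).toOpenPartialHomeomorph.trans Sp11.chartOne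

instance : ChartedSpace sp11 Sp11 where
  atlas := Set.range Sp11.chart
  chartAt := Sp11.chart
  mem_chart_source g := by
    simp only [Sp11.chart, Sp11.chartOne, OpenPartialHomeomorph.trans_source]
    refine ⟨trivial, ?_⟩
    change IsUnit (1 + ((g⁻¹ * g : Sp11) : QMat))
    rw [inv_mul_cancel]
    change IsUnit (1 + (1 : QMat))
    rw [← two_smul ℝ (1 : QMat)]
    exact isUnit_two_smul isUnit_one
  chart_mem_atlas g := ⟨g, rfl⟩

/-- The Cayley charts make `Sp(1,1)` a smooth manifold, embedded in `M₂(ℍ)`. -/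
instance : IsManifold 𝓘(ℝ, sp11) ∞ Sp11 := by
  refine isManifold_of_contDiffOn _ _ _ ?_
  classical
  rintro _ _ ⟨g, rfl⟩ ⟨g', rfl⟩
  have key : ContDiffOn ℝ ∞ (fun X : sp11 =>
      sp11Proj (cayley (((g'⁻¹ * g : Sp11) : QMat) * cayley (X : QMat))))
      {X | IsUnit (1 + (X : QMat)) ∧
        IsUnit (1 + ((g'⁻¹ * g : Sp11) : QMat) * cayley (X : QMat))} := by
    refine sp11Proj.contDiff.comp_contDiffOn (contDiffOn_cayley.comp ?_ fun X hX => hX.2)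
    refine contDiffOn_const.mul ?_
    exact contDiffOn_cayley.comp sp11.subtypeL.contDiff.contDiffOn fun X hX => hX.1
  have hval : ∀ X : sp11, IsUnit (1 + (X : QMat)) →
      ((g'⁻¹ * ((Sp11.chart g).symm X) : Sp11) : QMat)
        = ((g'⁻¹ * g : Sp11) : QMat) * cayley (X : QMat) := by
    intro X hX
    have h1 : (Sp11.chart g).symm X = g * ⟨cayley X, cayley_mem_Sp11 X.2 hX⟩ := by
      change g⁻¹⁻¹ * (if h : IsUnit (1 + (X : QMat)) then
        (⟨cayley X, cayley_mem_Sp11 X.2 h⟩ : Sp11) else 1) = _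
      rw [dif_pos hX, inv_inv]
    rw [h1, ← mul_assoc]
    rfl
  have hsub : ∀ X ∈ ((Sp11.chart g).symm ≫ₕ Sp11.chart g').source,
      IsUnit (1 + (X : QMat)) ∧
        IsUnit (1 + ((g'⁻¹ * g : Sp11) : QMat) * cayley (X : QMat)) := by
    intro X hX
    have hX1 : IsUnit (1 + (X : QMat)) := hX.1.1
    have hX2 : IsUnit (1 + ((g'⁻¹ * ((Sp11.chart g).symm X) : Sp11) : QMat)) := hX.2.2
    rw [hval X hX1] at hX2
    exact ⟨hX1, hX2⟩
  refine (key.mono fun X hX => hsub X hX.1).congr fun X hX => ?_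
  have hX1 := (hsub X hX.1).1
  change sp11Proj (cayley ((g'⁻¹ * ((Sp11.chart g).symm X) : Sp11) : QMat)) = _
  rw [hval X hX1]

/-! ### Slice regular functions on the unit ball and regular Möbius transformations -/

/-- The open unit ball `𝔹` of `ℍ`. -/
def QBall : TopologicalSpace.Opens ℍ[ℝ] := ⟨Metric.ball 0 1, Metric.isOpen_ball⟩

theorem QBall.norm_lt (q : QBall) : ‖(q : ℍ[ℝ])‖ < 1 := mem_ball_zero_iff.1 q.2

instance : Zero QBall := ⟨⟨0, Metric.mem_ball_self one_pos⟩⟩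

/-- `f` has the power series expansion `f(q) = ∑ qⁿ aₙ` on `𝔹`, with right coefficients. -/
def HasSliceExpansion (f : QBall → ℍ[ℝ]) (a : ℕ → ℍ[ℝ]) : Prop :=
  ∀ q : QBall, HasSum (fun n => (q : ℍ[ℝ]) ^ n * a n) (f q)

open Classical in
/-- The coefficients of the power series expansion of a slice regular function on `𝔹`
(and `0` for a function without such an expansion). -/
def sliceCoeff (f : QBall → ℍ[ℝ]) : ℕ → ℍ[ℝ] :=
  if h : ∃ a, HasSliceExpansion f a then h.choose else 0

/-- The regular product `(f * g)(q) = ∑ qⁿ (∑ₖ aₖ bₙ₋ₖ)`. -/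
def starMul (f g : QBall → ℍ[ℝ]) : QBall → ℍ[ℝ] := fun q =>
  ∑' n, (q : ℍ[ℝ]) ^ n * ∑ k ∈ Finset.range (n + 1), sliceCoeff f k * sliceCoeff g (n - k)

/-- The regular conjugate `fᶜ(q) = ∑ qⁿ (star aₙ)`. -/
def regConj (f : QBall → ℍ[ℝ]) : QBall → ℍ[ℝ] := fun q =>
  ∑' n, (q : ℍ[ℝ]) ^ n * star (sliceCoeff f n)

/-- The symmetrization `fˢ = f * fᶜ`. -/
def regSymm (f : QBall → ℍ[ℝ]) : QBall → ℍ[ℝ] := starMul f (regConj f)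

/-- The regular reciprocal `f^{-*} = (1 / fˢ) fᶜ`. -/
def starInv (f : QBall → ℍ[ℝ]) : QBall → ℍ[ℝ] := fun q => (regSymm f q)⁻¹ * regConj f q

/-- The function `l_{(a,b)}(q) = q a + b`. -/
def sliceAffine (a b : ℍ[ℝ]) : QBall → ℍ[ℝ] := fun q => (q : ℍ[ℝ]) * a + b

/-- For the matrix `A` with rows `(a, c)` and `(b, d)`, the function
`l_{(c,d)}^{-*} * l_{(a,b)}`, that is, `(q c + d)^{-*} * (q a + b)`. -/
def regMobiusFun (A : QMat) : QBall → ℍ[ℝ] :=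
  starMul (starInv (sliceAffine (A 0 1) (A 1 1))) (sliceAffine (A 0 0) (A 1 0))

/-- The real one-variable power series with coefficients `cₙ`. -/
def realSeries (c : ℕ → ℍ[ℝ]) : FormalMultilinearSeries ℝ ℝ ℍ[ℝ] :=
  fun n => ContinuousMultilinearMap.mkPiRing ℝ (Fin n) (c n)

theorem realSeries_coeff (c : ℕ → ℍ[ℝ]) (n : ℕ) : (realSeries c).coeff n = c n := by
  simp [FormalMultilinearSeries.coeff, realSeries]

theorem HasSliceExpansion.unique {f : QBall → ℍ[ℝ]} {a b : ℕ → ℍ[ℝ]}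
    (ha : HasSliceExpansion f a) (hb : HasSliceExpansion f b) : a = b := by
  classical
  have key : ∀ c : ℕ → ℍ[ℝ], HasSliceExpansion f c →
      HasFPowerSeriesAt (fun t : ℝ => if h : ((t : ℍ[ℝ])) ∈ QBall then f ⟨t, h⟩ else 0)
        (realSeries c) 0 := by
    intro c hc
    refine hasFPowerSeriesAt_iff.2 ?_
    filter_upwards [Metric.ball_mem_nhds (0 : ℝ) one_pos] with t ht
    have h : (t : ℍ[ℝ]) ∈ QBall := by
      change (t : ℍ[ℝ]) ∈ Metric.ball 0 1
      rw [mem_ball_zero_iff, Quaternion.norm_coe]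
      exact mem_ball_zero_iff.1 ht
    rw [zero_add, dif_pos h]
    have e := hc ⟨t, h⟩
    simp only [← Quaternion.coe_pow, Quaternion.coe_mul_eq_smul] at e
    simpa only [realSeries_coeff] using e
  have h := (key a ha).eq_formalMultilinearSeries (key b hb)
  funext n
  have h2 := congrArg (fun p => FormalMultilinearSeries.coeff p n) h
  simpa only [realSeries_coeff] using h2

theorem HasSliceExpansion.sliceCoeff_eq {f : QBall → ℍ[ℝ]} {a : ℕ → ℍ[ℝ]}
    (ha : HasSliceExpansion f a) : sliceCoeff f = a := by
  have h : ∃ a, HasSliceExpansion f a := ⟨a, ha⟩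
  rw [sliceCoeff, dif_pos h]
  exact h.choose_spec.unique ha

/-- The sequence `(b, a, 0, 0, …)`. -/
def affineCoeff (a b : ℍ[ℝ]) : ℕ → ℍ[ℝ]
  | 0 => b
  | 1 => a
  | _ + 2 => 0

theorem hasSum_affineCoeff (q a b : ℍ[ℝ]) :
    HasSum (fun n => q ^ n * affineCoeff a b n) (q * a + b) := by
  have h := hasSum_sum_of_ne_finset_zero (L := SummationFilter.unconditional ℕ)
    (s := Finset.range 2)
    (f := fun n => q ^ n * affineCoeff a b n) (by
      intro n hn
      match n, hn with
      | n + 2, _ => simp [affineCoeff]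
      | 0, h => simp at h
      | 1, h => simp at h)
  convert h using 1
  simp [Finset.sum_range_succ, affineCoeff, add_comm]

theorem sliceCoeff_affine (a b : ℍ[ℝ]) : sliceCoeff (sliceAffine a b) = affineCoeff a b :=
  HasSliceExpansion.sliceCoeff_eq fun q => hasSum_affineCoeff q a b

theorem regConj_affine (a b : ℍ[ℝ]) :
    regConj (sliceAffine a b) = sliceAffine (star a) (star b) := by
  funext q
  rw [regConj, sliceCoeff_affine]
  refine HasSum.tsum_eq ?_
  change HasSum _ ((q : ℍ[ℝ]) * star a + star b)
  convert hasSum_affineCoeff (q : ℍ[ℝ]) (star a) (star b) using 2 with n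
  match n with
  | 0 => rfl
  | 1 => rfl
  | n + 2 => simp [affineCoeff]

/-- Right multiplication of a power series by a polynomial of degree one. -/
theorem starMul_affine {f : QBall → ℍ[ℝ]} {e : ℕ → ℍ[ℝ]} (hf : HasSliceExpansion f e)
    (a b : ℍ[ℝ]) (q : QBall) :
    starMul f (sliceAffine a b) q = f q * b + q * f q * a := by
  rw [starMul, hf.sliceCoeff_eq, sliceCoeff_affine]
  have h1 : HasSum (fun n => (q : ℍ[ℝ]) ^ n * (e n * b)) (f q * b) := by
    simpa only [mul_assoc] using (hf q).mul_right b
  have h2 : HasSum (fun n => (q : ℍ[ℝ]) ^ (n + 1) * (e n * a)) (q * f q * a) := by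
    simpa only [mul_assoc, pow_succ'] using ((hf q).mul_left (q : ℍ[ℝ])).mul_right a
  refine HasSum.tsum_eq ?_
  rw [← hasSum_nat_add_iff' 1] at h1 ⊢
  convert h1.add h2 using 1
  · funext n
    rw [← mul_add, Finset.sum_range_succ, Finset.sum_range_succ]
    have h0 : ∑ k ∈ Finset.range n, e k * affineCoeff a b (n + 1 - k) = 0 := by
      refine Finset.sum_eq_zero fun k hk => ?_
      obtain ⟨m, hm⟩ : ∃ m, n + 1 - k = m + 2 := ⟨n - k - 1, by
        have := Finset.mem_range.1 hk; omega⟩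
      rw [hm]; simp [affineCoeff]
    rw [h0, zero_add]
    have h3 : n + 1 - n = 1 := by omega
    rw [h3, Nat.sub_self]
    simp only [affineCoeff]
    rw [add_comm (e n * a)]
  · simp [affineCoeff]
    abel

/-- The symmetrization of `q c + d`. -/
theorem regSymm_affine (c d : ℍ[ℝ]) (q : QBall) :
    regSymm (sliceAffine c d) q
      = (q * c + d) * star d + q * (q * c + d) * star c := by
  have h : HasSliceExpansion (sliceAffine c d) (affineCoeff c d) :=
    fun q => hasSum_affineCoeff q c d
  rw [regSymm, regConj_affine, starMul_affine h]
  rfl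

theorem regSymm_affine_real (c d q : ℍ[ℝ]) :
    (q * c + d) * star d + q * (q * c + d) * star c
      = q * q * ((Quaternion.normSq c : ℝ) : ℍ[ℝ]) + q * ((2 * (c * star d).re : ℝ) : ℍ[ℝ])
        + ((Quaternion.normSq d : ℝ) : ℍ[ℝ]) := by
  have h1 : c * star d + d * star c = ((2 * (c * star d).re : ℝ) : ℍ[ℝ]) := by
    ext <;> simp <;> ring
  rw [← h1, ← Quaternion.self_mul_star, ← Quaternion.self_mul_star]
  simp only [mul_add, add_mul, mul_assoc]
  abel

theorem regSymm_affine_eq (c d q : ℍ[ℝ]) :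
    (q * c + d) * star d + q * (q * c + d) * star c
      = (q * star c + star d) * d + q * (q * star c + star d) * c := by
  have h1 : star c * d + star d * c = ((2 * (c * star d).re : ℝ) : ℍ[ℝ]) := by
    ext <;> simp <;> ring
  rw [regSymm_affine_real, ← h1, ← Quaternion.star_mul_self, ← Quaternion.star_mul_self]
  simp only [mul_add, add_mul, mul_assoc]
  abel

theorem regSymm_affine_comm (c d q : ℍ[ℝ]) :
    Commute q ((q * c + d) * star d + q * (q * c + d) * star c) := by
  rw [regSymm_affine_real]
  have h (r : ℝ) : Commute q (r : ℍ[ℝ]) := (Quaternion.coe_commutes r q).symm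
  exact ((((Commute.refl q).mul_right (Commute.refl q)).mul_right (h _)).add_right
    ((Commute.refl q).mul_right (h _))).add_right (h _)

theorem affine_eq_zero {c d q x : ℍ[ℝ]} (hcd : ‖c‖ < ‖d‖) (hq : ‖q‖ < 1)
    (hx : x * d + q * x * c = 0) : x = 0 := by
  by_contra hne
  have h1 : ‖x‖ * ‖d‖ = ‖q‖ * ‖x‖ * ‖c‖ := by
    rw [← norm_mul, ← norm_mul, ← norm_mul, eq_neg_of_add_eq_zero_left hx, norm_neg]
  have h2 : 0 < ‖x‖ := norm_pos_iff.2 hne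
  have h3 : ‖q‖ * ‖c‖ ≤ 1 * ‖c‖ := mul_le_mul_of_nonneg_right hq.le (norm_nonneg c)
  nlinarith [mul_lt_mul_of_pos_left hcd h2]

theorem affine_conj_ne_zero {c d q : ℍ[ℝ]} (hcd : ‖c‖ < ‖d‖) (hq : ‖q‖ < 1) :
    q * star c + star d ≠ 0 := by
  intro h
  have h1 : ‖q‖ * ‖c‖ = ‖d‖ := by
    rw [← norm_star c, ← norm_mul, eq_neg_of_add_eq_zero_left h, norm_neg, norm_star]
  have h3 : ‖q‖ * ‖c‖ ≤ 1 * ‖c‖ := mul_le_mul_of_nonneg_right hq.le (norm_nonneg c)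
  linarith

theorem regSymm_affine_ne_zero {c d q : ℍ[ℝ]} (hcd : ‖c‖ < ‖d‖) (hq : ‖q‖ < 1) :
    (q * c + d) * star d + q * (q * c + d) * star c ≠ 0 := by
  rw [regSymm_affine_eq]
  exact fun h => affine_conj_ne_zero hcd hq (affine_eq_zero hcd hq h)

theorem hasSliceExpansion_starInv {c d : ℍ[ℝ]} (hcd : ‖c‖ < ‖d‖) :
    HasSliceExpansion (starInv (sliceAffine c d)) fun n => (-(d⁻¹ * c)) ^ n * d⁻¹ := by
  intro q
  have hd : d ≠ 0 := norm_pos_iff.1 ((norm_nonneg c).trans_lt hcd)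
  have hsum : Summable fun n : ℕ => (q : ℍ[ℝ]) ^ n * ((-(d⁻¹ * c)) ^ n * d⁻¹) := by
    have hr : ‖d⁻¹ * c‖ < 1 := by
      rw [norm_mul, norm_inv, inv_mul_lt_one₀ (norm_pos_iff.2 hd)]
      exact hcd
    refine Summable.of_norm_bounded
      ((summable_geometric_of_lt_one (norm_nonneg _) hr).mul_right ‖d⁻¹‖) fun n => ?_
    rw [norm_mul, norm_mul, norm_pow, norm_pow, norm_neg]
    calc ‖(q : ℍ[ℝ])‖ ^ n * (‖d⁻¹ * c‖ ^ n * ‖d⁻¹‖) ≤ 1 * (‖d⁻¹ * c‖ ^ n * ‖d⁻¹‖) :=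
          mul_le_mul_of_nonneg_right (pow_le_one₀ (norm_nonneg _) (QBall.norm_lt q).le) (by positivity)
      _ = _ := one_mul _
  obtain ⟨S, hS⟩ := hsum
  have h1 : S * d + q * S * c = 1 := by
    have e1 := hS.mul_right d
    have e2 := (hS.mul_left (q : ℍ[ℝ])).mul_right c
    rw [← hasSum_nat_add_iff' 1] at e1
    have e3 := e1.add e2
    have e4 : (fun n : ℕ => (q : ℍ[ℝ]) ^ (n + 1) * ((-(d⁻¹ * c)) ^ (n + 1) * d⁻¹) * d
        + q * ((q : ℍ[ℝ]) ^ n * ((-(d⁻¹ * c)) ^ n * d⁻¹)) * c) = fun _ => 0 := by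
      funext n
      have : (-(d⁻¹ * c)) ^ (n + 1) * d⁻¹ * d = -((-(d⁻¹ * c)) ^ n * d⁻¹ * c) := by
        rw [mul_assoc, inv_mul_cancel₀ hd, mul_one, pow_succ, mul_neg, ← mul_assoc]
      rw [mul_assoc _ _ d, this, pow_succ']
      simp only [mul_neg, mul_assoc]
      abel
    rw [e4] at e3
    have e5 := e3.unique hasSum_zero
    simp only [Finset.range_one, Finset.sum_singleton, pow_zero, one_mul,
      inv_mul_cancel₀ hd] at e5
    rw [← sub_eq_zero, ← e5]
    abel
  set N := ((q : ℍ[ℝ]) * c + d) * star d + q * (q * c + d) * star c with hN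
  have hN0 : N ≠ 0 := regSymm_affine_ne_zero hcd (QBall.norm_lt q)
  have hval : starInv (sliceAffine c d) q = N⁻¹ * (q * star c + star d) := by
    rw [starInv, regSymm_affine, regConj_affine]
    rfl
  have hcomm : Commute (q : ℍ[ℝ]) N⁻¹ := (regSymm_affine_comm c d q).inv_right₀
  have h2 : (N⁻¹ * (q * star c + star d)) * d + q * (N⁻¹ * (q * star c + star d)) * c = 1 := by
    rw [← mul_assoc (q : ℍ[ℝ]), hcomm.eq, mul_assoc, mul_assoc, mul_assoc, ← mul_add,
      ← mul_assoc (q : ℍ[ℝ]), ← regSymm_affine_eq, inv_mul_cancel₀ hN0]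
  have h3 : S - N⁻¹ * (q * star c + star d) = 0 := by
    refine affine_eq_zero hcd (QBall.norm_lt q) ?_
    rw [← sub_eq_zero.2 (h1.trans h2.symm)]
    simp only [sub_mul, mul_sub]
    abel
  rw [hval, ← sub_eq_zero.1 h3]
  exact hS

/-- Closed form of `(q c + d)^{-*} * (q a + b)`. -/
theorem regMobiusFun_eq {A : QMat} (hcd : ‖A 0 1‖ < ‖A 1 1‖) (q : QBall) :
    regMobiusFun A q
      = (((q : ℍ[ℝ]) * A 0 1 + A 1 1) * star (A 1 1)
          + q * (q * A 0 1 + A 1 1) * star (A 0 1))⁻¹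
        * ((q * star (A 0 1) + star (A 1 1)) * A 1 0
          + q * (q * star (A 0 1) + star (A 1 1)) * A 0 0) := by
  rw [regMobiusFun, starMul_affine (hasSliceExpansion_starInv hcd), starInv, regSymm_affine,
    regConj_affine]
  have hcomm := (regSymm_affine_comm (A 0 1) (A 1 1) (q : ℍ[ℝ])).inv_right₀
  change _ * ((q : ℍ[ℝ]) * star (A 0 1) + star (A 1 1)) * _
    + q * (_ * ((q : ℍ[ℝ]) * star (A 0 1) + star (A 1 1))) * _ = _
  rw [← mul_assoc (q : ℍ[ℝ]), hcomm.eq]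
  generalize (_ : ℍ[ℝ])⁻¹ = M
  simp only [mul_add, add_mul, mul_assoc]

theorem Sp11.entries (A : Sp11) :
    (A : QMat) 0 0 * star ((A : QMat) 0 0) - (A : QMat) 0 1 * star ((A : QMat) 0 1) = 1 ∧
    (A : QMat) 1 0 * star ((A : QMat) 1 0) - (A : QMat) 1 1 * star ((A : QMat) 1 1) = -1 ∧
    (A : QMat) 1 0 * star ((A : QMat) 0 0) - (A : QMat) 1 1 * star ((A : QMat) 0 1) = 0 := by
  have h := (Sp11.mul_mul_conj A)
  have h00 := congrFun (congrFun h 0) 0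
  have h11 := congrFun (congrFun h 1) 1
  have h10 := congrFun (congrFun h 1) 0
  simp [I11, Matrix.mul_apply, Fin.sum_univ_two, ← sub_eq_add_neg] at h00 h11 h10
  exact ⟨h00, h11, h10⟩

theorem Sp11.normSq_entries (A : Sp11) :
    Quaternion.normSq ((A : QMat) 0 0) - Quaternion.normSq ((A : QMat) 0 1) = 1 ∧
    Quaternion.normSq ((A : QMat) 1 0) - Quaternion.normSq ((A : QMat) 1 1) = -1 := by
  obtain ⟨h1, h2, -⟩ := (Sp11.entries A)
  rw [Quaternion.self_mul_star, Quaternion.self_mul_star] at h1 h2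
  have h3 := congrArg (fun x : ℍ[ℝ] => x.re) h1
  have h4 := congrArg (fun x : ℍ[ℝ] => x.re) h2
  exact ⟨by simpa using h3, by simpa using h4⟩

theorem Sp11.norm_lt (A : Sp11) : ‖(A : QMat) 0 1‖ < ‖(A : QMat) 1 1‖ := by
  have h := congrFun (congrFun (Sp11.conj_mul_mul A) 1) 1
  simp [I11, Matrix.mul_apply, Fin.sum_univ_two] at h
  rw [Quaternion.star_mul_self, Quaternion.star_mul_self] at h
  have h2 : Quaternion.normSq ((A : QMat) 0 1) + -Quaternion.normSq ((A : QMat) 1 1) = -1 := by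
    simpa using congrArg (fun x : ℍ[ℝ] => x.re) h
  rw [Quaternion.normSq_eq_norm_mul_self, Quaternion.normSq_eq_norm_mul_self] at h2
  nlinarith [norm_nonneg ((A : QMat) 0 1), norm_nonneg ((A : QMat) 1 1)]

theorem regMobiusFun_mem (A : Sp11) (q : QBall) : regMobiusFun A q ∈ QBall := by
  obtain ⟨h1, h2⟩ := (Sp11.normSq_entries A)
  have h3 := (Sp11.entries A).2.2
  have hcd := (Sp11.norm_lt A)
  have hh := affine_conj_ne_zero hcd (QBall.norm_lt q)
  have hN := regSymm_affine_ne_zero hcd (QBall.norm_lt q)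
  have hq := (QBall.norm_lt q)
  change _ ∈ Metric.ball (0 : ℍ[ℝ]) 1
  rw [mem_ball_zero_iff, regMobiusFun_eq hcd, norm_mul, norm_inv,
    inv_mul_lt_one₀ (norm_pos_iff.2 hN)]
  rw [regSymm_affine_eq]
  set a := (A : QMat) 0 0
  set b := (A : QMat) 1 0
  set c := (A : QMat) 0 1
  set d := (A : QMat) 1 1
  set h := (q : ℍ[ℝ]) * star c + star d
  have hpos : 0 < Quaternion.normSq h :=
    lt_of_le_of_ne Quaternion.normSq_nonneg fun h0 => hh (Quaternion.normSq_eq_zero.1 h0.symm)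
  have hq2 : Quaternion.normSq (q : ℍ[ℝ]) < 1 := by
    rw [Quaternion.normSq_eq_norm_mul_self]
    nlinarith [norm_nonneg (q : ℍ[ℝ])]
  have hcross : h * b * star (q * h * a) = h * d * star (q * h * c) := by
    have : b * star a = d * star c := sub_eq_zero.1 h3
    simp only [star_mul]
    calc h * b * (star a * (star h * star (q : ℍ[ℝ])))
        = h * (b * star a) * (star h * star (q : ℍ[ℝ])) := by simp only [mul_assoc]
      _ = _ := by rw [this]; simp only [mul_assoc]
  have key : Quaternion.normSq (h * d + (q : ℍ[ℝ]) * h * c) - Quaternion.normSq (h * b + (q : ℍ[ℝ]) * h * a)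
      = Quaternion.normSq h * (1 - Quaternion.normSq (q : ℍ[ℝ])) := by
    rw [Quaternion.normSq_add, Quaternion.normSq_add, hcross]
    simp only [map_mul]
    linear_combination (-Quaternion.normSq h) * h2
      - Quaternion.normSq (q : ℍ[ℝ]) * Quaternion.normSq h * h1
  have key2 : Quaternion.normSq (h * b + (q : ℍ[ℝ]) * h * a) < Quaternion.normSq (h * d + (q : ℍ[ℝ]) * h * c) := by
    have := mul_pos hpos (sub_pos.2 hq2)
    linarith
  rw [Quaternion.normSq_eq_norm_mul_self, Quaternion.normSq_eq_norm_mul_self] at key2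
  exact lt_of_mul_self_lt_mul_self₀ (norm_nonneg _) key2

/-- The regular Möbius transformation `𝓕_A : 𝔹 → 𝔹`, `𝓕_A(q) = (q c + d)^{-*} * (q a + b)`, of the
matrix `A ∈ Sp(1,1)` with rows `(a, c)` and `(b, d)`. -/
def mobius (A : Sp11) (q : QBall) : QBall := ⟨regMobiusFun A q, regMobiusFun_mem A q⟩

/-- The set `𝓜(𝔹) = {𝓕_A : A ∈ Sp(1,1)}` of all regular Möbius transformations of `𝔹`. -/
def RegMobius : Type := {F : QBall → QBall // ∃ A : Sp11, F = mobius A}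

instance : CoeFun RegMobius fun _ => QBall → QBall := ⟨Subtype.val⟩

@[ext]
theorem RegMobius.ext {F G : RegMobius} (h : ∀ q, F q = G q) : F = G :=
  Subtype.ext (funext h)

/-- The map `Sp(1,1) → 𝓜(𝔹)`, `A ↦ 𝓕_{A⁻¹}`. -/
def mobiusInvMap (A : Sp11) : RegMobius := ⟨mobius A⁻¹, A⁻¹, rfl⟩

/-- The group `Sp(1)` of unit quaternions, with Mathlib's manifold structure on the sphere. -/
abbrev Sp1 : Type := Metric.sphere (0 : ℍ[ℝ]) 1

instance : Fact (Module.finrank ℝ ℍ[ℝ] = 3 + 1) := ⟨Quaternion.finrank_eq_four⟩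

/-- The diagonal matrix `diag(u, 1)`. -/
def diagSp11 (u : Sp1) : Sp11 := ⟨!![(u : ℍ[ℝ]), 0; 0, 1], by
  have h : star (u : ℍ[ℝ]) * u = 1 := by
    rw [Quaternion.star_mul_self, Quaternion.normSq_eq_norm_mul_self, mem_sphere_zero_iff_norm.1 u.2]
    simp
  change _ * I11 * _ = I11
  refine Matrix.ext fun i j => ?_
  fin_cases i <;> fin_cases j <;> simp [I11, Matrix.mul_apply, Fin.sum_univ_two, h]⟩

/-- Right multiplication by a unit quaternion on values corresponds to `A ↦ A diag(u, 1)`. -/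
theorem mobius_mul_diag (A : Sp11) (u : Sp1) (q : QBall) :
    (mobius (A * diagSp11 u) q : ℍ[ℝ]) = mobius A q * u := by
  have e1 : ((A * diagSp11 u : Sp11) : QMat) 0 1 = (A : QMat) 0 1 := by
    simp [diagSp11, Matrix.mul_apply, Fin.sum_univ_two]
  have e2 : ((A * diagSp11 u : Sp11) : QMat) 1 1 = (A : QMat) 1 1 := by
    simp [diagSp11, Matrix.mul_apply, Fin.sum_univ_two]
  have e3 : ((A * diagSp11 u : Sp11) : QMat) 0 0 = (A : QMat) 0 0 * u := by
    simp [diagSp11, Matrix.mul_apply, Fin.sum_univ_two]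
  have e4 : ((A * diagSp11 u : Sp11) : QMat) 1 0 = (A : QMat) 1 0 * u := by
    simp [diagSp11, Matrix.mul_apply, Fin.sum_univ_two]
  change regMobiusFun _ q = regMobiusFun _ q * u
  rw [regMobiusFun_eq (Sp11.norm_lt _), regMobiusFun_eq (Sp11.norm_lt A), e1, e2, e3, e4]
  generalize (_ : ℍ[ℝ])⁻¹ = M
  simp only [add_mul, mul_assoc]

theorem mobius_one (q : QBall) : mobius 1 q = q := by
  refine Subtype.ext ?_
  change regMobiusFun _ q = q
  rw [regMobiusFun_eq (Sp11.norm_lt 1)]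
  simp

/-- The isotropy `𝓜(𝔹)₀ = {𝓕 ∈ 𝓜(𝔹) : 𝓕(0) = 0}`, with the subspace topology whenever `𝓜(𝔹)` is
given a topology. -/
abbrev RegMobiusZero : Type := {F : RegMobius // F 0 = 0}

/-- The transformation `R_u(q) = q u`. -/
def rightMul (u : Sp1) : RegMobiusZero :=
  ⟨⟨mobius (diagSp11 u), diagSp11 u, rfl⟩, by
    refine Subtype.ext ?_
    change (mobius (diagSp11 u) 0 : ℍ[ℝ]) = 0
    rw [← one_mul (diagSp11 u), mobius_mul_diag, mobius_one]
    exact zero_mul _⟩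

theorem rightMul_apply (u : Sp1) (q : QBall) : ((rightMul u).1 q : ℍ[ℝ]) = q * u := by
  change (mobius (diagSp11 u) q : ℍ[ℝ]) = q * u
  rw [← one_mul (diagSp11 u), mobius_mul_diag, mobius_one]

theorem exists_eq_rightMul (F : RegMobiusZero) : ∃ u : Sp1, F = rightMul u := by
  obtain ⟨⟨F, A, rfl⟩, hF⟩ := F
  obtain ⟨h1, h2⟩ := Sp11.normSq_entries A
  have h3 := (Sp11.entries A).2.2
  have hcd := Sp11.norm_lt A
  have hd : (A : QMat) 1 1 ≠ 0 := norm_pos_iff.1 ((norm_nonneg _).trans_lt hcd)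
  have hb : (A : QMat) 1 0 = 0 := by
    have h := congrArg (fun q : QBall => (q : ℍ[ℝ])) hF
    change regMobiusFun _ 0 = 0 at h
    rw [regMobiusFun_eq hcd] at h
    have hz : ((0 : QBall) : ℍ[ℝ]) = 0 := rfl
    simpa [hz, hd] using h
  rw [hb] at h2 h3
  have hc : (A : QMat) 0 1 = 0 := by simpa [hd] using h3
  have hdn : Quaternion.normSq ((A : QMat) 1 1) = 1 := by simp at h2; linarith
  have han : Quaternion.normSq ((A : QMat) 0 0) = 1 := by rw [hc] at h1; simpa using h1
  have hu : ‖star ((A : QMat) 1 1) * (A : QMat) 0 0‖ = 1 := by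
    rw [norm_mul, norm_star]
    rw [Quaternion.normSq_eq_norm_mul_self] at hdn han
    rw [(mul_self_eq_one_iff.1 hdn).resolve_right fun h => by
        linarith [norm_nonneg ((A : QMat) 1 1)],
      (mul_self_eq_one_iff.1 han).resolve_right fun h => by
        linarith [norm_nonneg ((A : QMat) 0 0)], one_mul]
  refine ⟨⟨star ((A : QMat) 1 1) * (A : QMat) 0 0, mem_sphere_zero_iff_norm.2 hu⟩, ?_⟩
  refine Subtype.ext (RegMobius.ext fun q => Subtype.ext ?_)
  rw [rightMul_apply]
  change regMobiusFun _ q = _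
  rw [regMobiusFun_eq hcd, hb, hc]
  have hdd : (A : QMat) 1 1 * star ((A : QMat) 1 1) = 1 := by
    rw [Quaternion.self_mul_star, hdn]; rfl
  simp [hdd, mul_assoc]

/-- The left action of `𝓜(𝔹)₀` on `𝓜(𝔹)` by composition, `(𝓕₀, 𝓕) ↦ 𝓕₀ ∘ 𝓕`. -/
instance : SMul RegMobiusZero RegMobius where
  smul F₀ F := ⟨F₀.1.1 ∘ F.1, by
    obtain ⟨u, rfl⟩ := exists_eq_rightMul F₀
    obtain ⟨F, A, rfl⟩ := F
    refine ⟨A * diagSp11 u, funext fun q => Subtype.ext ?_⟩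
    rw [mobius_mul_diag]
    exact rightMul_apply u _⟩

/-- `𝓜(𝔹)₀` is a group for the composition of maps. -/
instance : Group RegMobiusZero where
  mul F G := ⟨⟨F.1.1 ∘ G.1.1, (F • G.1).2⟩, by
    change F.1 (G.1 0) = 0
    rw [G.2, F.2]⟩
  mul_assoc _ _ _ := rfl
  one := ⟨⟨id, 1, funext fun q => (mobius_one q).symm⟩, rfl⟩
  one_mul _ := rfl
  mul_one _ := rfl
  inv F := rightMul (exists_eq_rightMul F).choose⁻¹
  inv_mul_cancel F := by
    refine Subtype.ext (RegMobius.ext fun q => Subtype.ext ?_)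
    change ((rightMul (exists_eq_rightMul F).choose⁻¹).1 (F.1 q) : ℍ[ℝ]) = q
    have h := (exists_eq_rightMul F).choose_spec
    have h2 : (F.1 q : ℍ[ℝ]) = q * (exists_eq_rightMul F).choose := by
      rw [← rightMul_apply, ← h]
    rw [rightMul_apply, h2, mul_assoc]
    have h3 : (((exists_eq_rightMul F).choose * (exists_eq_rightMul F).choose⁻¹ : Sp1) : ℍ[ℝ])
        = 1 := by rw [mul_inv_cancel]; rfl
    change (q : ℍ[ℝ]) * (((exists_eq_rightMul F).choose * (exists_eq_rightMul F).choose⁻¹ : Sp1) :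
      ℍ[ℝ]) = q
    rw [h3, mul_one]

instance : MulAction RegMobiusZero RegMobius where
  one_smul _ := rfl
  mul_smul _ _ _ := rfl

/-- The inverse orbit map `𝓜(𝔹) → 𝔹`, `𝓕 ↦ 𝓕⁻¹(0)`. -/
def inverseOrbit (F : RegMobius) : QBall := Function.invFun F 0

/-! ### Submersions and principal fiber bundles -/

section Bundles

variable {EG HG EP HP EB HB : Type*}
  [NormedAddCommGroup EG] [NormedSpace ℝ EG] [TopologicalSpace HG]
  [NormedAddCommGroup EP] [NormedSpace ℝ EP] [TopologicalSpace HP]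
  [NormedAddCommGroup EB] [NormedSpace ℝ EB] [TopologicalSpace HB]
  (IG : ModelWithCorners ℝ EG HG) (IP : ModelWithCorners ℝ EP HP) (IB : ModelWithCorners ℝ EB HB)
  (G : Type*) {P B : Type*}
  [TopologicalSpace G] [ChartedSpace HG G] [Group G]
  [TopologicalSpace P] [ChartedSpace HP P]
  [TopologicalSpace B] [ChartedSpace HB B] [MulAction G P]

/-- A submersion: a surjective smooth map whose differential at every point is surjective. -/
structure IsSurjectiveSubmersion (π : P → B) : Prop where
  contMDiff : ContMDiff IP IB ∞ π
  surjective : Function.Surjective π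
  mfderiv_surjective : ∀ p, Function.Surjective (mfderiv IP IB π p)

/-- `π : P → B` is a principal fiber bundle with structure Lie group `G` acting on the left on the
total space `P`. -/
structure IsLeftPrincipalBundle (π : P → B) : Prop where
  manifold_total : IsManifold IP ∞ P
  manifold_base : IsManifold IB ∞ B
  lieGroup : LieGroup IG ∞ G
  submersion : IsSurjectiveSubmersion IP IB π
  smooth_action : ContMDiff (IG.prod IP) IP ∞ fun x : G × P => x.1 • x.2
  free : ∀ (g : G) (p : P), g • p = p → g = 1
  proper : ∀ K : Set P, IsCompact K → IsCompact {g : G | (((g • ·) '' K) ∩ K).Nonempty}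
  fibers : ∀ p p' : P, π p = π p' ↔ ∃ g : G, g • p = p'
  /-- Around every point of `B` there are an open set `U` and a `G`-equivariant diffeomorphism of
  `U × G` onto `π⁻¹(U)` over `U`. -/
  locally_trivial : ∀ b : B, ∃ U : Set B, IsOpen U ∧ b ∈ U ∧
    ∃ φ : OpenPartialHomeomorph (B × G) P,
      φ.source = U ×ˢ Set.univ ∧ φ.target = π ⁻¹' U ∧
      ContMDiffOn (IB.prod IG) IP ∞ φ φ.source ∧
      ContMDiffOn IP (IB.prod IG) ∞ φ.symm φ.target ∧
      (∀ x ∈ U, ∀ g : G, π (φ (x, g)) = x) ∧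
      (∀ x ∈ U, ∀ g h : G, φ (x, g * h) = g • φ (x, h))

/-- The bundle is globally trivial: there is a `G`-equivariant diffeomorphism of `B × G` onto `P`
over `B`. -/
def IsGloballyTrivial (π : P → B) : Prop :=
  ∃ φ : Diffeomorph (IB.prod IG) IP (B × G) P ∞,
    (∀ (x : B) (g : G), π (φ (x, g)) = x) ∧
    (∀ (x : B) (g h : G), φ (x, g * h) = g • φ (x, h))

end Bundles

/-- The topology and the atlas make `𝓜(𝔹)` a `7`-dimensional smooth manifold for which
`Sp(1,1) → 𝓜(𝔹)`, `A ↦ 𝓕_{A⁻¹}`, is a submersion. As the fibers of this map are the cosets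
`A Sp(1) I₂`, this means that the bijection `Sp(1,1)/Sp(1)I₂ → 𝓜(𝔹)` is a diffeomorphism for the
quotient manifold structure on `Sp(1,1)/Sp(1)I₂`. -/
structure IsQuotientManifold [TopologicalSpace RegMobius]
    [ChartedSpace (EuclideanSpace ℝ (Fin 7)) RegMobius] : Prop where
  manifold : IsManifold (𝓡 7) ∞ RegMobius
  hausdorff : T2Space RegMobius
  second_countable : SecondCountableTopology RegMobius
  submersion : IsSurjectiveSubmersion 𝓘(ℝ, sp11) (𝓡 7) mobiusInvMap

end

/-! ### Closed form and bijectivity of regular Möbius transformations -/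

/-! For `A` with rows `(a, c)` and `(b, d)` put `x = b d⁻¹` and `w = a d⁻¹`. The relations `A* I₁₁ A
= I₁₁ = A I₁₁ A*` give `|b| = |c| < |d|`, `|a| = |d|` and `c = w x̄ d`. Hence `A` is the matrix with
rows `(w, w x̄)`, `(x, 1)` times the scalar `d` on the right, and `|d|² (1 - |x|²) = 1`: the pair
`(x, w) ∈ 𝔹 × Sp(1)` determines `A` up to a unit scalar on the right (`exists_eq_boost_mul`).

In the closed form of `𝓕_{A⁻¹}` the real number `|d|²` cancels, leaving `𝓕_{A⁻¹}(q) = M_x(q) w̄`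
with `M_x = (1 - q x̄)^{-*} * (q - x)` (`mobiusInvMap_apply`). Replacing `q` by its conjugate `p =
(1 - q x)⁻¹ q (1 - q x)` turns `M_x(q)` into the classical `(1 - p x̄)⁻¹ (p - x)`, and this change
of variable can be undone; so every transformation is bijective, with `x` as its only zero. Once `x`
is known, any nonzero value gives back `w`. Therefore `A ↦ (x, w)` has the same fibers as `A ↦
𝓕_{A⁻¹}`, and `(x, w) ↦ M_x w̄` is a bijection `𝔹 × Sp(1) → 𝓜(𝔹)` (`boostEquiv`). In these
coordinates the inverse orbit map is the first projection, composition with `q ↦ q u⁻¹` is `w ↦ u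
w`, and the isotropy group is the slice `x = 0`.

For an arbitrary admissible manifold structure this bijection is a diffeomorphism
(`boostDiffeomorph`). It is smooth as the composition of the smooth section `boost` with the
submersion; its inverse is smooth because, precomposed with the submersion, it becomes the smooth
map `Sp11.coords`, and smoothness descends along submersions (`contMDiff_of_comp_submersion`). The
bundle statements are then read off from the product `𝔹 × Sp(1)`, with properness coming from
compactness of `Sp(1)`. Existence of a structure follows by transporting that of the product. -/

theorem one_sub_mul_ne_zero {q x : ℍ[ℝ]} (hq : ‖q‖ < 1) (hx : ‖x‖ < 1) : 1 - q * x ≠ 0 := by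
  intro h
  have h1 : ‖q * x‖ = 1 := by rw [← sub_eq_zero.1 h, norm_one]
  rw [norm_mul] at h1
  nlinarith [norm_nonneg q, norm_nonneg x]

theorem one_add_mul_ne_zero {q x : ℍ[ℝ]} (hq : ‖q‖ < 1) (hx : ‖x‖ < 1) : 1 + q * x ≠ 0 := by
  have := one_sub_mul_ne_zero (q := -q) (by rwa [norm_neg]) hx
  rwa [neg_mul, sub_neg_eq_add] at this

/-- The regular Möbius transformation `(1 - q x̄)^{-*} * (q - x)`. -/
noncomputable def mobiusFactor (x q : ℍ[ℝ]) : ℍ[ℝ] :=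
  ((1 - q * x) - q * (1 - q * x) * star x)⁻¹ * (q * (1 - q * x) - (1 - q * x) * x)

/-- Conjugating by `1 - q x` turns the regular Möbius transformation into the classical one. -/
theorem mobiusFactor_eq {x q p : ℍ[ℝ]} (hx : ‖x‖ < 1) (hq : ‖q‖ < 1)
    (hp : (1 - q * x) * p = q * (1 - q * x)) :
    mobiusFactor x q = (1 - p * star x)⁻¹ * (p - x) := by
  have hh := one_sub_mul_ne_zero hq hx
  have h1 : (1 - q * x) - q * (1 - q * x) * star x = (1 - q * x) * (1 - p * star x) := by
    rw [← hp, mul_sub, mul_one, mul_assoc]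
  have h2 : q * (1 - q * x) - (1 - q * x) * x = (1 - q * x) * (p - x) := by
    rw [← hp, mul_sub]
  rw [mobiusFactor, h1, h2, mul_inv_rev, mul_assoc, inv_mul_cancel_left₀ hh]

theorem norm_eq_of_conj {f p q : ℍ[ℝ]} (hf : f ≠ 0) (h : f * p = q * f) : ‖p‖ = ‖q‖ := by
  have h1 := congrArg norm h
  rw [norm_mul, norm_mul, mul_comm] at h1
  exact mul_right_cancel₀ (norm_ne_zero_iff.2 hf) h1

/-- Conjugation by `1 - q x` is inverted by conjugation by `1 - p x̄`. -/
theorem conj_one_sub_swap {x q p : ℍ[ℝ]} (hx : ‖x‖ < 1) (hq : ‖q‖ < 1)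
    (hp : (1 - q * x) * p = q * (1 - q * x)) :
    (1 - p * star x) * q = p * (1 - p * star x) := by
  apply mul_left_cancel₀ (one_sub_mul_ne_zero hq hx)
  -- This product is the symmetrization of `1 - q x`, the affine function with coefficients `-x` and
  -- `1`. It is a polynomial in `q` with real coefficients, hence commutes with `q`.
  have e : (1 - q * x) * (1 - p * star x)
      = (q * -x + 1) * star 1 + q * (q * -x + 1) * star (-x) := by
    rw [mul_sub, ← mul_assoc, hp]
    simp [sub_eq_add_neg, add_comm]
  have hc := regSymm_affine_comm (-x) 1 q
  rw [← e] at hc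
  rw [← mul_assoc, ← hc.eq, ← mul_assoc, ← mul_assoc, ← hp]

theorem exists_conj_one_sub {x q : ℍ[ℝ]} (hx : ‖x‖ < 1) (hq : ‖q‖ < 1) :
    ∃ p : ℍ[ℝ], ‖p‖ < 1 ∧ (1 - q * x) * p = q * (1 - q * x) := by
  have hh := one_sub_mul_ne_zero hq hx
  have h : (1 - q * x) * ((1 - q * x)⁻¹ * (q * (1 - q * x))) = q * (1 - q * x) :=
    mul_inv_cancel_left₀ hh _
  exact ⟨_, (norm_eq_of_conj hh h).trans_lt hq, h⟩

theorem mobiusFactor_self {x : ℍ[ℝ]} : mobiusFactor x x = 0 := by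
  rw [mobiusFactor]
  simp [mul_sub, sub_mul, mul_assoc]

/-- The classical formula can be solved for the conjugated variable: `p (1 + x̄ y) = y + x`, so the
value `y` determines `p`. Then `p` determines `q`, since `q` is the conjugate of `p` by `1 - p x̄`.
-/
theorem mobiusFactor_injective {x q q' : ℍ[ℝ]} (hx : ‖x‖ < 1) (hq : ‖q‖ < 1) (hq' : ‖q'‖ < 1)
    (hy : ‖mobiusFactor x q‖ < 1) (h : mobiusFactor x q = mobiusFactor x q') : q = q' := by
  have hx' : ‖star x‖ < 1 := by rwa [norm_star]
  have key : ∀ p : ℍ[ℝ], ‖p‖ < 1 → ∀ y : ℍ[ℝ], y = (1 - p * star x)⁻¹ * (p - x) →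
      p * (1 + star x * y) = y + x := by
    intro p hp y hy
    have h1 : (1 - p * star x) * y = p - x := by
      rw [hy, mul_inv_cancel_left₀ (one_sub_mul_ne_zero hp hx')]
    rw [sub_mul, one_mul, sub_eq_sub_iff_add_eq_add] at h1
    rw [mul_add, mul_one, ← mul_assoc, h1]
  obtain ⟨p, hp, e⟩ := exists_conj_one_sub hx hq
  obtain ⟨p', hp', e'⟩ := exists_conj_one_sub hx hq'
  have k := key p hp _ (mobiusFactor_eq hx hq e)
  have k' := key p' hp' _ (h.trans (mobiusFactor_eq hx hq' e'))
  have hpp : p = p' := mul_right_cancel₀ (one_add_mul_ne_zero hx' hy) (k.trans k'.symm)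
  subst hpp
  exact mul_left_cancel₀ (one_sub_mul_ne_zero hp hx')
    ((conj_one_sub_swap hx hq e).trans (conj_one_sub_swap hx hq' e').symm)

/-- The difference of the squared norms factors as `(1 - |x|²)(1 - |y|²)`. This keeps the preimage
under the classical transformation inside the ball. -/
theorem norm_add_lt_norm_one_add {x y : ℍ[ℝ]} (hx : ‖x‖ < 1) (hy : ‖y‖ < 1) :
    ‖y + x‖ < ‖1 + star x * y‖ := by
  have h : Quaternion.normSq (1 + star x * y) - Quaternion.normSq (y + x)
      = (1 - Quaternion.normSq x) * (1 - Quaternion.normSq y) := by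
    rw [Quaternion.normSq_add, Quaternion.normSq_add, map_mul, Quaternion.normSq_star]
    have : (1 * star (star x * y)).re = (y * star x).re := by simp
    rw [this, map_one]
    ring
  simp only [Quaternion.normSq_eq_norm_mul_self] at h
  have := norm_nonneg x
  have := norm_nonneg y
  refine lt_of_mul_self_lt_mul_self₀ (norm_nonneg _) (sub_pos.1 ?_)
  rw [h]
  exact mul_pos (by nlinarith) (by nlinarith)

theorem mobiusFactor_surjective {x y : ℍ[ℝ]} (hx : ‖x‖ < 1) (hy : ‖y‖ < 1) :
    ∃ q : ℍ[ℝ], ‖q‖ < 1 ∧ mobiusFactor x q = y := by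
  have hx' : ‖star x‖ < 1 := by rwa [norm_star]
  have h0 := one_add_mul_ne_zero hx' hy
  set p := (y + x) * (1 + star x * y)⁻¹ with hpdef
  have hp : ‖p‖ < 1 := by
    rw [hpdef, norm_mul, norm_inv, mul_inv_lt_iff₀ (norm_pos_iff.2 h0), one_mul]
    exact norm_add_lt_norm_one_add hx hy
  -- The conjugation is applied to `p` with `x̄` in the role of `x`; the swap lemma then shows that
  -- `p` is the conjugate of `q` by `1 - q x`.
  obtain ⟨q, hq, e⟩ := exists_conj_one_sub hx' hp
  have e' := conj_one_sub_swap hx' hp e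
  rw [star_star] at e'
  refine ⟨q, hq, ?_⟩
  rw [mobiusFactor_eq hx hq e', inv_mul_eq_iff_eq_mul₀ (one_sub_mul_ne_zero hp hx')]
  have h1 : p * (1 + star x * y) = y + x := by
    rw [hpdef, mul_assoc, inv_mul_cancel₀ h0, mul_one]
  rw [mul_add, mul_one, ← mul_assoc] at h1
  rw [sub_mul, one_mul, sub_eq_sub_iff_add_eq_add, h1]

/-! ### Coordinates on `Sp(1,1)` and the closed form of `𝓕_{A⁻¹}` -/

/-- The first diagonal entries of `A* I₁₁ A` and of `A I₁₁ A*` read `|a|² - |b|² = 1` and `|a|² -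
|c|² = 1`. -/
theorem Sp11.normSq_entries_conj (A : Sp11) :
    Quaternion.normSq ((A : QMat) 1 0) = Quaternion.normSq ((A : QMat) 0 1) := by
  have h := congrFun (congrFun (Sp11.conj_mul_mul A) 0) 0
  simp only [I11, Matrix.mul_apply, Fin.sum_univ_two, Matrix.conjTranspose_apply] at h
  simp only [Matrix.of_apply, Matrix.cons_val_zero, Matrix.cons_val_one, Matrix.cons_val', mul_one,
    mul_zero, add_zero, zero_add, mul_neg, neg_mul, Quaternion.star_mul_self,
    Matrix.cons_val_fin_one] at h
  have h2 := congrArg (fun x : ℍ[ℝ] => x.re) h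
  have h3 := (Sp11.normSq_entries A).1
  simp at h2
  linarith

theorem Sp11.lower_ne_zero (A : Sp11) : (A : QMat) 1 1 ≠ 0 :=
  norm_pos_iff.1 ((norm_nonneg _).trans_lt (Sp11.norm_lt A))

/-- The zero of `𝓕_{A⁻¹}` together with the unitary factor of `𝓕_{A⁻¹}`. -/
noncomputable def Sp11.coords (A : Sp11) : QBall × Sp1 :=
  (⟨(A : QMat) 1 0 * ((A : QMat) 1 1)⁻¹, by
      have h := Sp11.norm_lt A
      have h1 := Sp11.normSq_entries_conj A
      change _ ∈ Metric.ball (0 : ℍ[ℝ]) 1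
      rw [Quaternion.normSq_eq_norm_mul_self, Quaternion.normSq_eq_norm_mul_self,
        mul_self_inj (norm_nonneg _) (norm_nonneg _)] at h1
      rw [mem_ball_zero_iff, norm_mul, norm_inv,
        mul_inv_lt_iff₀ (norm_pos_iff.2 (Sp11.lower_ne_zero A)), one_mul, h1]
      exact h⟩,
    ⟨(A : QMat) 0 0 * ((A : QMat) 1 1)⁻¹, by
      obtain ⟨h1, h2⟩ := Sp11.normSq_entries A
      have h3 := Sp11.normSq_entries_conj A
      have h4 : Quaternion.normSq ((A : QMat) 0 0) = Quaternion.normSq ((A : QMat) 1 1) := by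
        linarith
      rw [Quaternion.normSq_eq_norm_mul_self, Quaternion.normSq_eq_norm_mul_self,
        mul_self_inj (norm_nonneg _) (norm_nonneg _)] at h4
      rw [mem_sphere_zero_iff_norm, norm_mul, norm_inv, h4,
        mul_inv_cancel₀ (norm_ne_zero_iff.2 (Sp11.lower_ne_zero A))]⟩)

theorem Sp11.coords_fst (A : Sp11) :
    ((Sp11.coords A).1 : ℍ[ℝ]) = (A : QMat) 1 0 * ((A : QMat) 1 1)⁻¹ := rfl

theorem Sp11.coords_snd (A : Sp11) :
    ((Sp11.coords A).2 : ℍ[ℝ]) = (A : QMat) 0 0 * ((A : QMat) 1 1)⁻¹ := rfl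

theorem Sp11.entry_eq (A : Sp11) :
    (A : QMat) 1 0 = (Sp11.coords A).1 * (A : QMat) 1 1 ∧
      (A : QMat) 0 0 = (Sp11.coords A).2 * (A : QMat) 1 1 := by
  have hd := (Sp11.lower_ne_zero A)
  rw [Sp11.coords_fst A, Sp11.coords_snd A, inv_mul_cancel_right₀ hd, inv_mul_cancel_right₀ hd]
  exact ⟨rfl, rfl⟩

/-- Conjugating the off-diagonal relation `b ā = d c̄` gives `c d̄ = a b̄ = w d d̄ x̄`. Since `d d̄`
is real it moves past `x̄`, and `d̄` cancels. -/
theorem Sp11.entry_zero_one (A : Sp11) :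
    (A : QMat) 0 1 = (Sp11.coords A).2 * star ((Sp11.coords A).1 : ℍ[ℝ]) * (A : QMat) 1 1 := by
  have hd := (Sp11.lower_ne_zero A)
  have hs : star ((A : QMat) 1 1) ≠ 0 := star_ne_zero.2 hd
  have h := congrArg star (sub_eq_zero.1 (Sp11.entries A).2.2)
  simp only [star_mul, star_star] at h
  apply mul_right_cancel₀ hs
  rw [← h, (Sp11.entry_eq A).1, star_mul, ← mul_assoc, (Sp11.entry_eq A).2, mul_assoc _ _ (star _),
    mul_assoc _ _ (star _), Quaternion.self_mul_star, mul_assoc, mul_assoc, ← mul_assoc _ (star _),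
    Quaternion.self_mul_star, Quaternion.coe_commutes]

theorem Sp11.inv_coe (A : Sp11) : ((A⁻¹ : Sp11) : QMat) = I11 * (A : QMat)ᴴ * I11 := rfl

/-- The inverse of `A` has rows `(ā, -b̄)` and `(-c̄, d̄)`. After `a`, `b`, `c` are expressed
through `x`, `w`, `d`, the only trace of `d` in numerator and denominator is the common real factor
`|d|²`; this is the invariance under right unit scalars. -/
theorem mobiusInvMap_apply (A : Sp11) (q : QBall) :
    (mobiusInvMap A q : ℍ[ℝ]) = mobiusFactor (Sp11.coords A).1 q * star ((Sp11.coords A).2 : ℍ[ℝ]) := by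
  change regMobiusFun (A⁻¹ : Sp11) q = _
  rw [regMobiusFun_eq (Sp11.norm_lt _), regSymm_affine_eq]
  have e00 : ((A⁻¹ : Sp11) : QMat) 0 0 = star ((A : QMat) 0 0) := by
    simp [Sp11.inv_coe, I11, Matrix.mul_apply, Fin.sum_univ_two, Matrix.vecMul, Matrix.vecHead, Matrix.vecTail]
  have e01 : ((A⁻¹ : Sp11) : QMat) 0 1 = -star ((A : QMat) 1 0) := by
    simp [Sp11.inv_coe, I11, Matrix.mul_apply, Fin.sum_univ_two, Matrix.vecMul, Matrix.vecHead, Matrix.vecTail]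
  have e10 : ((A⁻¹ : Sp11) : QMat) 1 0 = -star ((A : QMat) 0 1) := by
    simp [Sp11.inv_coe, I11, Matrix.mul_apply, Fin.sum_univ_two, Matrix.vecMul, Matrix.vecHead, Matrix.vecTail]
  have e11 : ((A⁻¹ : Sp11) : QMat) 1 1 = star ((A : QMat) 1 1) := by
    simp [Sp11.inv_coe, I11, Matrix.mul_apply, Fin.sum_univ_two, Matrix.vecMul, Matrix.vecHead, Matrix.vecTail]
  rw [e00, e01, e10, e11, (Sp11.entry_zero_one A), (Sp11.entry_eq A).1, (Sp11.entry_eq A).2]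
  have hd := (Sp11.lower_ne_zero A)
  have hn : ((Quaternion.normSq ((A : QMat) 1 1) : ℝ) : ℍ[ℝ]) ≠ 0 := by
    rw [← Quaternion.self_mul_star]
    exact mul_ne_zero hd (star_ne_zero.2 hd)
  generalize (A : QMat) 1 1 = d at *
  generalize ((Sp11.coords A).1 : ℍ[ℝ]) = x at *
  generalize ((Sp11.coords A).2 : ℍ[ℝ]) = w at *
  simp only [star_neg, star_star, star_mul]
  have hh : (q : ℍ[ℝ]) * -(x * d) + d = (1 - q * x) * d := by
    rw [sub_mul, one_mul, mul_neg, ← mul_assoc]; abel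
  -- Each term of the numerator and denominator contains this pattern: `d` meets `d̄`, and the real
  -- product moves to the front.
  have hN (z : ℍ[ℝ]) : (1 - (q : ℍ[ℝ]) * x) * d * (star d * z)
      = ((Quaternion.normSq d : ℝ) : ℍ[ℝ]) * ((1 - q * x) * z) := by
    rw [mul_assoc, ← mul_assoc d, Quaternion.self_mul_star, ← mul_assoc, ← Quaternion.coe_commutes,
      mul_assoc]
  have hN1 : (1 - (q : ℍ[ℝ]) * x) * d * star d
      = ((Quaternion.normSq d : ℝ) : ℍ[ℝ]) * (1 - q * x) := by
    simpa using hN 1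
  have hq (z : ℍ[ℝ]) : (q : ℍ[ℝ]) * (((Quaternion.normSq d : ℝ) : ℍ[ℝ]) * z)
      = ((Quaternion.normSq d : ℝ) : ℍ[ℝ]) * (q * z) := by
    rw [← mul_assoc, ← Quaternion.coe_commutes, mul_assoc]
  have hden : (1 - (q : ℍ[ℝ]) * x) * d * star d + q * ((1 - q * x) * d) * -(star d * star x)
      = ((Quaternion.normSq d : ℝ) : ℍ[ℝ]) * ((1 - q * x) - q * (1 - q * x) * star x) := by
    rw [mul_neg, mul_assoc (q : ℍ[ℝ]), hN, hN1, hq, ← sub_eq_add_neg, ← mul_sub,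
      mul_assoc (q : ℍ[ℝ])]
  have hnum : (1 - (q : ℍ[ℝ]) * x) * d * -(star d * (x * star w))
        + q * ((1 - q * x) * d) * (star d * star w)
      = ((Quaternion.normSq d : ℝ) : ℍ[ℝ])
        * ((q * (1 - q * x) - (1 - q * x) * x) * star w) := by
    rw [mul_neg, mul_assoc (q : ℍ[ℝ]), hN, hN, hq, neg_add_eq_sub, ← mul_sub]
    simp only [sub_mul _ _ (star w), mul_assoc]
  rw [hh, hden, hnum, mul_inv_rev, mul_assoc, inv_mul_cancel_left₀ hn, mobiusFactor, ← mul_assoc]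

theorem mobiusInvMap_eq_of_coords {A A' : Sp11} (h : (Sp11.coords A) = (Sp11.coords A')) :
    mobiusInvMap A = mobiusInvMap A' := by
  refine RegMobius.ext fun q => Subtype.ext ?_
  rw [mobiusInvMap_apply, mobiusInvMap_apply, h]

theorem star_mul_self_Sp1 (w : Sp1) : star (w : ℍ[ℝ]) * w = 1 := by
  rw [Quaternion.star_mul_self, Quaternion.normSq_eq_norm_mul_self, mem_sphere_zero_iff_norm.1 w.2]
  simp

theorem Sp1.coe_inv (w : Sp1) : ((w⁻¹ : Sp1) : ℍ[ℝ]) = star (w : ℍ[ℝ]) := by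
  have h : ((w⁻¹ : Sp1) : ℍ[ℝ]) = (w : ℍ[ℝ])⁻¹ := rfl
  rw [h, eq_comm]
  exact eq_inv_of_mul_eq_one_left (star_mul_self_Sp1 w)

/-! ### Bijectivity, the zero, and the fibers of `A ↦ 𝓕_{A⁻¹}` -/

theorem mobiusInvMap_bijective (A : Sp11) : Function.Bijective (mobiusInvMap A) := by
  have hx := QBall.norm_lt (Sp11.coords A).1
  have hw : ‖star ((Sp11.coords A).2 : ℍ[ℝ])‖ = 1 := by
    rw [norm_star, mem_sphere_zero_iff_norm.1 (Sp11.coords A).2.2]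
  have hw0 : star ((Sp11.coords A).2 : ℍ[ℝ]) ≠ 0 :=
    norm_ne_zero_iff.1 (by rw [hw]; exact one_ne_zero)
  have hnorm (q : QBall) : ‖mobiusFactor (Sp11.coords A).1 q‖ < 1 := by
    have := QBall.norm_lt (mobiusInvMap A q)
    rwa [mobiusInvMap_apply, norm_mul, hw, mul_one] at this
  constructor
  · intro q q' h
    have h1 := congrArg (fun y : QBall => (y : ℍ[ℝ])) h
    simp only [mobiusInvMap_apply] at h1
    exact Subtype.ext (mobiusFactor_injective hx (QBall.norm_lt q) (QBall.norm_lt q') (hnorm q)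
      (mul_right_cancel₀ hw0 h1))
  · intro y
    obtain ⟨q, hq, h⟩ := mobiusFactor_surjective (y := y * (Sp11.coords A).2) hx (by
      rw [norm_mul, mem_sphere_zero_iff_norm.1 (Sp11.coords A).2.2, mul_one]; exact QBall.norm_lt y)
    refine ⟨⟨q, mem_ball_zero_iff.2 hq⟩, Subtype.ext ?_⟩
    rw [mobiusInvMap_apply]
    change mobiusFactor _ q * _ = _
    have h2 : ((Sp11.coords A).2 : ℍ[ℝ]) * star ((Sp11.coords A).2 : ℍ[ℝ]) = 1 := by
      rw [← star_mul_self_Sp1 (Sp11.coords A).2⁻¹, Sp1.coe_inv, star_star]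
    rw [h, mul_assoc, h2, mul_one]

theorem mobiusInvMap_surjective : Function.Surjective mobiusInvMap := by
  rintro ⟨F, A, rfl⟩
  exact ⟨A⁻¹, Subtype.ext (by change mobius A⁻¹⁻¹ = _; rw [inv_inv])⟩

theorem RegMobius.bijective (F : RegMobius) : Function.Bijective F := by
  obtain ⟨A, rfl⟩ := mobiusInvMap_surjective F
  exact mobiusInvMap_bijective A

theorem inverseOrbit_eq_iff (F : RegMobius) (x : QBall) : inverseOrbit F = x ↔ F x = 0 := by
  constructor
  · rintro rfl
    exact Function.invFun_eq (F.bijective.2 0)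
  · intro h
    rw [inverseOrbit, ← h]
    exact Function.leftInverse_invFun F.bijective.1 x

theorem inverseOrbit_mobiusInvMap (A : Sp11) : inverseOrbit (mobiusInvMap A) = (Sp11.coords A).1 := by
  rw [inverseOrbit_eq_iff]
  refine Subtype.ext ?_
  rw [mobiusInvMap_apply, mobiusFactor_self, zero_mul]
  rfl

/-- The first coordinate is the zero of the transformation. The factor `M_x` is then common to both
sides, and cancelling it at a point where it does not vanish identifies the unitary factors. -/
theorem coords_eq_of_mobiusInvMap {A A' : Sp11} (h : mobiusInvMap A = mobiusInvMap A') :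
    (Sp11.coords A) = (Sp11.coords A') := by
  have h1 : (Sp11.coords A).1 = (Sp11.coords A').1 := by
    rw [← inverseOrbit_mobiusInvMap, h, inverseOrbit_mobiusInvMap]
  refine Prod.ext h1 (Subtype.ext ?_)
  -- Any nonzero value serves: at a preimage of it the factor `M_x` cannot vanish.
  obtain ⟨y, hy⟩ : ∃ y : QBall, y ≠ 0 := by
    refine ⟨⟨((1 / 2 : ℝ) : ℍ[ℝ]), mem_ball_zero_iff.2 ?_⟩, fun h => ?_⟩
    · rw [Quaternion.norm_coe]; norm_num
    · have := congrArg (fun q : QBall => (q : ℍ[ℝ]).re) h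
      change (1 / 2 : ℝ) = 0 at this
      norm_num at this
  obtain ⟨q, hq⟩ := (mobiusInvMap_bijective A).2 y
  have e1 := mobiusInvMap_apply A q
  have e2 := mobiusInvMap_apply A' q
  rw [← h, ← h1, e1] at e2
  have h0 : mobiusFactor (Sp11.coords A).1 q ≠ 0 := by
    intro h0
    rw [h0, zero_mul, hq] at e1
    exact hy (Subtype.ext e1)
  exact star_injective (mul_left_cancel₀ h0 e2)

/-! ### Boosts: a section of the coordinates -/

/-- The inverse square root normalizing the boosts in `Sp(1,1)`. -/
noncomputable def boostScale (x : ℍ[ℝ]) : ℝ := (Real.sqrt (1 - ‖x‖ ^ 2))⁻¹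

theorem boostScale_pos {x : ℍ[ℝ]} (hx : ‖x‖ < 1) : 0 < boostScale x :=
  inv_pos.2 (Real.sqrt_pos.2 (by nlinarith [norm_nonneg x]))

theorem boostScale_sq {x : ℍ[ℝ]} (hx : ‖x‖ < 1) :
    boostScale x * boostScale x * (1 - Quaternion.normSq x) = 1 := by
  have h : 0 < 1 - ‖x‖ ^ 2 := by nlinarith [norm_nonneg x]
  rw [boostScale, ← mul_inv, Real.mul_self_sqrt h.le, Quaternion.normSq_eq_norm_mul_self, ← sq,
    inv_mul_cancel₀ h.ne']

/-- The matrix `(1 - |x|²)^{-1/2} (w, w x̄; x, 1)`. -/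
noncomputable def boostMatrix (x w : ℍ[ℝ]) : QMat :=
  boostScale x • (!![w, w * star x; x, 1] : QMat)

/-- The unscaled matrix carries `I₁₁` to `(1 - |x|²) I₁₁`, and the square of the scale is the
reciprocal of that factor. -/
theorem boostMatrix_mem {x w : ℍ[ℝ]} (hx : ‖x‖ < 1) (hw : star w * w = 1) :
    boostMatrix x w ∈ Sp11 := by
  have h : (!![w, w * star x; x, 1] : QMat)ᴴ * I11 * !![w, w * star x; x, 1]
      = (1 - Quaternion.normSq x) • I11 := by
    have h1 : star x * x = ((Quaternion.normSq x : ℝ) : ℍ[ℝ]) := Quaternion.star_mul_self x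
    have h2 : x * star x = ((Quaternion.normSq x : ℝ) : ℍ[ℝ]) := Quaternion.self_mul_star x
    have h3 (z : ℍ[ℝ]) : star w * (w * z) = z := by rw [← mul_assoc, hw, one_mul]
    refine Matrix.ext fun i j => ?_
    fin_cases i <;> fin_cases j <;>
      simp [I11, Matrix.mul_apply, Fin.sum_univ_two, mul_assoc, hw, h1, h2, h3,
        sub_smul, ← sub_eq_add_neg]
    all_goals rw [← Quaternion.coe_mul_eq_smul, mul_one]
  change (boostMatrix x w)ᴴ * I11 * boostMatrix x w = I11
  rw [boostMatrix, conjTranspose_real_smul, smul_mul_assoc, smul_mul_assoc, mul_smul_comm, h,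
    smul_smul, smul_smul, boostScale_sq hx, one_smul]

/-- The section of `A ↦ (zero of 𝓕_{A⁻¹}, unitary factor of 𝓕_{A⁻¹})` given by boosts. -/
noncomputable def boost (t : QBall × Sp1) : Sp11 :=
  ⟨boostMatrix t.1 t.2, boostMatrix_mem (QBall.norm_lt t.1) (star_mul_self_Sp1 t.2)⟩

theorem coords_boost (t : QBall × Sp1) : Sp11.coords (boost t) = t := by
  have hs := (boostScale_pos (QBall.norm_lt t.1)).ne'
  have key (z : ℍ[ℝ]) : (boostScale t.1 • z) * (boostScale (t.1 : ℍ[ℝ]) • (1 : ℍ[ℝ]))⁻¹ = z := by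
    have h1 : boostScale (t.1 : ℍ[ℝ]) • (1 : ℍ[ℝ]) ≠ 0 := smul_ne_zero hs one_ne_zero
    rw [mul_inv_eq_iff_eq_mul₀ h1, mul_smul_comm, mul_one]
  refine Prod.ext (Subtype.ext ?_) (Subtype.ext ?_)
  · exact key _
  · exact key _


/-- The scalar matrix `v I₂`. -/
noncomputable def scalarSp11 (v : Sp1) : Sp11 := ⟨!![(v : ℍ[ℝ]), 0; 0, (v : ℍ[ℝ])], by
  have h := star_mul_self_Sp1 v
  change _ * I11 * _ = I11
  refine Matrix.ext fun i j => ?_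
  fin_cases i <;> fin_cases j <;> simp [I11, Matrix.mul_apply, Fin.sum_univ_two, h]⟩

theorem mul_scalarSp11_apply (A : Sp11) (v : Sp1) (i j : Fin 2) :
    ((A * scalarSp11 v : Sp11) : QMat) i j = (A : QMat) i j * v := by
  fin_cases j <;> simp [scalarSp11, Matrix.mul_apply, Fin.sum_univ_two]

theorem coords_mul_scalarSp11 (A : Sp11) (v : Sp1) :
    Sp11.coords (A * scalarSp11 v) = Sp11.coords A := by
  have hv : (v : ℍ[ℝ]) ≠ 0 := ne_zero_of_mem_unit_sphere v
  refine Prod.ext (Subtype.ext ?_) (Subtype.ext ?_)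
  · rw [Sp11.coords_fst, Sp11.coords_fst, mul_scalarSp11_apply, mul_scalarSp11_apply, mul_inv_rev,
      mul_assoc, mul_inv_cancel_left₀ hv]
  · rw [Sp11.coords_snd, Sp11.coords_snd, mul_scalarSp11_apply, mul_scalarSp11_apply, mul_inv_rev,
      mul_assoc, mul_inv_cancel_left₀ hv]

/-- The boost has positive lower right entry, so the missing scalar must be the phase of `d`. The
moduli already agree because `|d|² (1 - |x|²) = 1` forces `|d|` to be the boost scale. The scalar is
needed later to move a section through a prescribed matrix. -/
theorem exists_eq_boost_mul (A : Sp11) : ∃ v : Sp1, A = boost (Sp11.coords A) * scalarSp11 v := by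
  have hd := Sp11.lower_ne_zero A
  have hdn : ‖(A : QMat) 1 1‖ ≠ 0 := norm_ne_zero_iff.2 hd
  have hs : boostScale (Sp11.coords A).1 = ‖(A : QMat) 1 1‖ := by
    have h1 := boostScale_sq (QBall.norm_lt (Sp11.coords A).1)
    have h2 := (Sp11.normSq_entries A).2
    rw [(Sp11.entry_eq A).1, map_mul] at h2
    have h3 : ‖(A : QMat) 1 1‖ * ‖(A : QMat) 1 1‖
        * (1 - Quaternion.normSq ((Sp11.coords A).1 : ℍ[ℝ])) = 1 := by
      rw [← Quaternion.normSq_eq_norm_mul_self]; linarith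
    have h4 : 1 - Quaternion.normSq ((Sp11.coords A).1 : ℍ[ℝ]) ≠ 0 := by
      rintro h
      rw [h, mul_zero] at h1
      exact zero_ne_one h1
    exact (mul_self_inj (boostScale_pos (QBall.norm_lt _)).le (norm_nonneg _)).1
      (mul_right_cancel₀ h4 (h1.trans h3.symm))
  refine ⟨⟨‖(A : QMat) 1 1‖⁻¹ • (A : QMat) 1 1, ?_⟩, ?_⟩
  · rw [mem_sphere_zero_iff_norm, norm_smul, norm_inv, norm_norm, inv_mul_cancel₀ hdn]
  · have key (z : ℍ[ℝ]) : boostScale (Sp11.coords A).1 • z * (‖(A : QMat) 1 1‖⁻¹ • (A : QMat) 1 1)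
        = z * (A : QMat) 1 1 := by
      rw [hs, smul_mul_smul_comm, mul_inv_cancel₀ hdn, one_smul]
    refine Subtype.ext (Matrix.ext fun i j => ?_)
    rw [mul_scalarSp11_apply]
    fin_cases i <;> fin_cases j
    · exact (Sp11.entry_eq A).2.trans (key _).symm
    · exact (Sp11.entry_zero_one A).trans (key _).symm
    · exact (Sp11.entry_eq A).1.trans (key _).symm
    · exact (one_mul _).symm.trans (key 1).symm

theorem mobiusInvMap_boost_coords (A : Sp11) :
    mobiusInvMap (boost (Sp11.coords A)) = mobiusInvMap A :=
  mobiusInvMap_eq_of_coords (coords_boost _)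

/-! ### Coordinates on `𝓜(𝔹)` and the isotropy group -/

/-- The bijection `𝔹 × Sp(1) → 𝓜(𝔹)` given by the zero and the unitary factor. -/
noncomputable def boostEquiv : QBall × Sp1 ≃ RegMobius where
  toFun t := mobiusInvMap (boost t)
  invFun F := Sp11.coords (mobiusInvMap_surjective F).choose
  left_inv t := by
    change Sp11.coords (mobiusInvMap_surjective (mobiusInvMap (boost t))).choose = t
    rw [coords_eq_of_mobiusInvMap (mobiusInvMap_surjective _).choose_spec, coords_boost]
  right_inv F := by
    change mobiusInvMap (boost (Sp11.coords (mobiusInvMap_surjective F).choose)) = F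
    rw [mobiusInvMap_boost_coords]
    exact (mobiusInvMap_surjective F).choose_spec

theorem boostEquiv_coords (A : Sp11) : boostEquiv (Sp11.coords A) = mobiusInvMap A :=
  mobiusInvMap_boost_coords A

theorem boostEquiv_symm_mobiusInvMap (A : Sp11) :
    boostEquiv.symm (mobiusInvMap A) = Sp11.coords A := by
  rw [Equiv.symm_apply_eq, boostEquiv_coords]

theorem inverseOrbit_boostEquiv (t : QBall × Sp1) : inverseOrbit (boostEquiv t) = t.1 := by
  change inverseOrbit (mobiusInvMap (boost t)) = t.1
  rw [inverseOrbit_mobiusInvMap, coords_boost]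

theorem boostEquiv_apply (t : QBall × Sp1) (q : QBall) :
    (boostEquiv t q : ℍ[ℝ]) = mobiusFactor t.1 q * star (t.2 : ℍ[ℝ]) := by
  change (mobiusInvMap (boost t) q : ℍ[ℝ]) = _
  rw [mobiusInvMap_apply, coords_boost]

/-- Composition multiplies values on the right by `ū`, and `w̄ ū` is the conjugate of `u w`. The
conjugation hidden in the unitary factor thus turns right multiplication of values into left
translation of `Sp(1)`. -/
theorem rightMul_smul_boostEquiv (u w : Sp1) (x : QBall) :
    rightMul u⁻¹ • boostEquiv (x, w) = boostEquiv (x, u * w) := by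
  refine RegMobius.ext fun q => Subtype.ext ?_
  change ((rightMul u⁻¹).1 (boostEquiv (x, w) q) : ℍ[ℝ]) = _
  rw [rightMul_apply, boostEquiv_apply, boostEquiv_apply, Sp1.coe_inv, mul_assoc, ← star_mul]
  rfl

/-- Since `M_0` is the identity, the isotropy group is the slice over the origin. -/
theorem boostEquiv_zero (w : Sp1) : boostEquiv (0, w) = (rightMul w⁻¹).1 := by
  refine RegMobius.ext fun q => Subtype.ext ?_
  have hz : ((0 : QBall) : ℍ[ℝ]) = 0 := rfl
  rw [boostEquiv_apply, rightMul_apply, Sp1.coe_inv, mobiusFactor, hz]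
  simp

theorem isotropy_map_mul (u v : Sp1) : rightMul (u * v)⁻¹ = rightMul u⁻¹ * rightMul v⁻¹ := by
  refine Subtype.ext (RegMobius.ext fun q => Subtype.ext ?_)
  change _ = ((rightMul u⁻¹).1 ((rightMul v⁻¹).1 q) : ℍ[ℝ])
  rw [rightMul_apply, rightMul_apply, rightMul_apply, mul_inv_rev, mul_assoc]
  rfl

theorem isotropy_map_bijective : Function.Bijective fun u : Sp1 => rightMul u⁻¹ := by
  constructor
  · intro u v h
    have h1 : boostEquiv (0, u) = boostEquiv (0, v) := by
      rw [boostEquiv_zero, boostEquiv_zero]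
      exact congrArg Subtype.val h
    exact (Prod.ext_iff.1 (boostEquiv.injective h1)).2
  · intro F
    obtain ⟨u, rfl⟩ := exists_eq_rightMul F
    exact ⟨u⁻¹, by change rightMul u⁻¹⁻¹ = _; rw [inv_inv]⟩

/-- The isomorphism `u ↦ (q ↦ q u⁻¹)` of `Sp(1)` onto `𝓜(𝔹)₀`. -/
noncomputable def isotropyEquiv : Sp1 ≃* RegMobiusZero :=
  MulEquiv.mk (Equiv.ofBijective _ isotropy_map_bijective) isotropy_map_mul

theorem boostEquiv_zero_left (w : Sp1) : boostEquiv (0, w) = (isotropyEquiv w).1 :=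
  boostEquiv_zero w

theorem isotropyEquiv_smul (u w : Sp1) (x : QBall) :
    isotropyEquiv u • boostEquiv (x, w) = boostEquiv (x, u * w) :=
  rightMul_smul_boostEquiv u w x

/-! ### Submersions and transport of manifold structures -/

section Manifolds

variable {E E' E'' H H' H'' M N P : Type*}
  [NormedAddCommGroup E] [NormedSpace ℝ E] [TopologicalSpace H]
  [NormedAddCommGroup E'] [NormedSpace ℝ E'] [TopologicalSpace H']
  [NormedAddCommGroup E''] [NormedSpace ℝ E''] [TopologicalSpace H'']
  {I : ModelWithCorners ℝ E H} {I' : ModelWithCorners ℝ E' H'} {I'' : ModelWithCorners ℝ E'' H''}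
  [TopologicalSpace M] [ChartedSpace H M] [TopologicalSpace N] [ChartedSpace H' N]
  [TopologicalSpace P] [ChartedSpace H'' P]

/-- By the chain rule for `f ∘ s = id`, the derivative of `s` is a right inverse of that of `f`.
This works only at points on the image of the section, hence the condition `s (f p) = p`. -/
theorem mfderiv_surjective_of_section {f : M → N} {s : N → M} {p : M}
    (hf : ContMDiff I I' ∞ f) (hs : ContMDiff I' I ∞ s) (hfs : ∀ y, f (s y) = y)
    (hp : s (f p) = p) : Function.Surjective (mfderiv I I' f p) := by
  have hf1 : MDifferentiableAt I I' f (s (f p)) := hf.mdifferentiable (by simp) _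
  have hs1 : MDifferentiableAt I' I s (f p) := hs.mdifferentiable (by simp) _
  have h1 := mfderiv_comp (f p) hf1 hs1
  have h2 : f ∘ s = id := funext hfs
  rw [h2, mfderiv_id, hp] at h1
  intro v
  exact ⟨mfderiv I' I s (f p) v, (DFunLike.congr_fun h1 v).symm⟩

/-- A map of finite-dimensional vector spaces with surjective derivative has a smooth local
section. -/
theorem exists_local_section [FiniteDimensional ℝ E'] [CompleteSpace E'] {g : E → E'} {a : E}
    (hg : ContDiffAt ℝ ∞ g a) (hs : Function.Surjective (fderiv ℝ g a)) :
    ∃ s : E' → E, ContDiffAt ℝ ∞ s (g a) ∧ s (g a) = a ∧ ∀ᶠ y in nhds (g a), g (s y) = y := by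
  obtain ⟨R₀, hR₀⟩ := LinearMap.exists_rightInverse_of_surjective
    (fderiv ℝ g a : E →ₗ[ℝ] E') (LinearMap.range_eq_top.2 hs)
  let R : E' →L[ℝ] E := LinearMap.toContinuousLinearMap R₀
  have hR (v : E') : fderiv ℝ g a (R v) = v := LinearMap.congr_fun hR₀ v
  -- An affine slice through `a` along a right inverse `R` of the derivative. The composition `g ∘
  -- j` has identity derivative at `g a`, so the inverse function theorem applies to it and needs no
  -- splitting of `E`.
  let j : E' → E := fun v => a + R (v - g a)
  have hj : ContDiff ℝ ∞ j := contDiff_const.add (R.contDiff.comp (contDiff_id.sub contDiff_const))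
  have hja : j (g a) = a := by simp [j]
  have hk : ContDiffAt ℝ ∞ (g ∘ j) (g a) := by
    refine ContDiffAt.comp _ ?_ hj.contDiffAt
    rwa [hja]
  have hd : HasFDerivAt (g ∘ j) ((ContinuousLinearEquiv.refl ℝ E' : E' ≃L[ℝ] E') : E' →L[ℝ] E')
      (g a) := by
    have h1 : HasFDerivAt j R (g a) := by
      have h0 : HasFDerivAt (fun v => v - g a) (ContinuousLinearMap.id ℝ E') (g a) :=
        (hasFDerivAt_id (g a)).sub_const (g a)
      have h := (HasFDerivAt.comp (g a) R.hasFDerivAt h0).const_add a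
      exact h
    have h2 : HasFDerivAt g (fderiv ℝ g a) (j (g a)) := by
      rw [hja]
      exact (hg.differentiableAt (by simp)).hasFDerivAt
    convert h2.comp (g a) h1 using 1
    ext v
    exact (hR v).symm
  have hka : (g ∘ j) (g a) = g a := congrArg g hja
  have hl := hk.to_localInverse hd (by simp)
  have hl' : hk.localInverse hd (by simp) (g a) = g a := by
    have := hk.localInverse_apply_image hd (by simp)
    rwa [hka] at this
  have hev := (hk.hasStrictFDerivAt' hd (by simp)).eventually_right_inverse
  rw [hka] at hl hev
  refine ⟨j ∘ hk.localInverse hd (by simp), hj.contDiffAt.comp _ hl, ?_, hev⟩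
  change j (hk.localInverse hd (by simp) (g a)) = a
  rw [hl', hja]

/-- A map out of the base of a submersion is smooth if its composition with the submersion is. -/
theorem contMDiff_of_comp_submersion [FiniteDimensional ℝ E']
    [I.Boundaryless] [I'.Boundaryless] [IsManifold I ∞ M] [IsManifold I' ∞ N]
    {π : M → N} (hπ : IsSurjectiveSubmersion I I' π) {f : N → P}
    (hf : ContMDiff I I'' ∞ (f ∘ π)) : ContMDiff I' I'' ∞ f := by
  have : CompleteSpace E' := FiniteDimensional.complete ℝ E'
  intro b
  obtain ⟨p, rfl⟩ := hπ.surjective b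
  set φ := extChartAt I p with hφ
  set ψ := extChartAt I' (π p) with hψ
  have h1 := (contMDiffAt_iff.1 (hπ.contMDiff p)).2
  rw [I.range_eq_univ, contDiffWithinAt_univ] at h1
  have h2 : Function.Surjective (fderiv ℝ (ψ ∘ π ∘ φ.symm) (φ p)) := by
    have h := hπ.mfderiv_surjective p
    rw [(hπ.contMDiff.mdifferentiable (by simp) p).mfderiv, I.range_eq_univ,
      fderivWithin_univ] at h
    exact h
  obtain ⟨s, hs, hsa, hsev⟩ := exists_local_section h1 h2
  have hga : (ψ ∘ π ∘ φ.symm) (φ p) = ψ (π p) := by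
    simp [hφ]
  rw [hga] at hs hsa hsev
  have hψs : ContMDiffAt I' 𝓘(ℝ, E') ∞ ψ (π p) := contMDiffAt_extChartAt
  have hφs : ContMDiffAt 𝓘(ℝ, E) I ∞ φ.symm (s (ψ (π p))) := by
    rw [hsa]
    have := contMDiffOn_extChartAt_symm (I := I) (n := ∞) p
    exact this.contMDiffAt (extChartAt_target_mem_nhds p)
  -- The local section of `π`, read back through the charts. Near `π p` the map `f` equals `f ∘ π`
  -- composed with it.
  have hσ : ContMDiffAt I' I ∞ (fun y => φ.symm (s (ψ y))) (π p) :=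
    hφs.comp (π p) (hs.contMDiffAt.comp (π p) hψs)
  have hσp : φ.symm (s (ψ (π p))) = p := by
    rw [hsa]; exact extChartAt_to_inv p
  have hev : ∀ᶠ y in nhds (π p), π (φ.symm (s (ψ y))) = y := by
    have hc : ContinuousAt (fun y => π (φ.symm (s (ψ y)))) (π p) :=
      hπ.contMDiff.continuous.continuousAt.comp hσ.continuousAt
    -- The section identity is known only after applying the chart `ψ`; both points must lie in its
    -- source for injectivity of `ψ` to remove it.
    have e1 : ∀ᶠ y in nhds (π p), π (φ.symm (s (ψ y))) ∈ ψ.source := by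
      refine hc.eventually_mem ?_
      rw [hσp]
      exact extChartAt_source_mem_nhds (π p)
    have e2 : ∀ᶠ y in nhds (π p), y ∈ ψ.source := extChartAt_source_mem_nhds (π p)
    filter_upwards [e1, e2, hψs.continuousAt.eventually hsev] with y h3 h4 h5
    exact ψ.injOn h3 h4 h5
  have hcomp : ContMDiffAt I' I'' ∞ (fun y => (f ∘ π) (φ.symm (s (ψ y)))) (π p) := by
    refine ContMDiffAt.comp (g := f ∘ π) (π p) ?_ hσ
    rw [hσp]
    exact hf p
  refine hcomp.congr_of_eventuallyEq ?_
  filter_upwards [hev] with y hy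
  exact (congrArg f hy).symm

/-- Transport of a manifold structure along a homeomorphism, with a change of model space. -/
theorem exists_chartedSpace_of_homeomorph {N : Type*} [TopologicalSpace N] [IsManifold I ∞ M]
    (h : M ≃ₜ N) (k : H ≃ₜ E') (hk : ContMDiff I 𝓘(ℝ, E') ∞ k)
    (hk' : ContMDiff 𝓘(ℝ, E') I ∞ k.symm) :
    ∃ _ : ChartedSpace E' N, IsManifold 𝓘(ℝ, E') ∞ N ∧ ContMDiff I 𝓘(ℝ, E') ∞ h ∧
      ContMDiff 𝓘(ℝ, E') I ∞ h.symm := by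
  let tr (c : OpenPartialHomeomorph M H) : OpenPartialHomeomorph N E' :=
    h.symm.toOpenPartialHomeomorph.trans (c.trans k.toOpenPartialHomeomorph)
  let C : ChartedSpace E' N :=
    { atlas := tr '' atlas H M
      chartAt := fun y => tr (chartAt H (h.symm y))
      mem_chart_source := fun y => by simp [tr]
      chart_mem_atlas := fun y => ⟨_, chart_mem_atlas H _, rfl⟩ }
  -- Each new chart is `k ∘ c ∘ h⁻¹`, so a transition map is `k ∘ c'` after `c⁻¹ ∘ k⁻¹`. Both halves
  -- are smooth for the original structure, which handles the change of model without comparing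
  -- structure groupoids.
  have hto (c) (hc : c ∈ atlas H M) : ContMDiffOn I 𝓘(ℝ, E') ∞ (k ∘ c) c.source :=
    hk.comp_contMDiffOn (contMDiffOn_of_mem_maximalAtlas (IsManifold.subset_maximalAtlas hc))
  have hfrom (c) (hc : c ∈ atlas H M) :
      ContMDiffOn 𝓘(ℝ, E') I ∞ (c.symm ∘ k.symm) (k.symm ⁻¹' c.target) :=
    (contMDiffOn_symm_of_mem_maximalAtlas (IsManifold.subset_maximalAtlas hc)).comp
      hk'.contMDiffOn fun _ hx => hx
  have hman : IsManifold 𝓘(ℝ, E') ∞ N := by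
    refine isManifold_of_contDiffOn _ _ _ ?_
    rintro _ _ ⟨c, hc, rfl⟩ ⟨c', hc', rfl⟩
    have := (hto c' hc').comp ((hfrom c hc).mono Set.inter_subset_left)
      (s := k.symm ⁻¹' c.target ∩ {x | c.symm (k.symm x) ∈ c'.source}) fun x hx => hx.2
    refine (this.contDiffOn.mono ?_).congr ?_
    · intro x hx
      simpa [tr] using hx
    · intro x hx
      simp [tr]
  refine ⟨C, hman, ?_, ?_⟩
  · intro x
    have hx : (h x) ∈ (chartAt E' (h x)).source := mem_chart_source E' (h x)
    have h1 := contMDiffOn_chart_symm (I := 𝓘(ℝ, E')) (n := ∞) (x := h x)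
    have h2 := (hto _ (chart_mem_atlas H x)).contMDiffAt (chart_source_mem_nhds H x)
    have h3 := (h1.contMDiffAt ((chartAt E' (h x)).open_target.mem_nhds
      ((chartAt E' (h x)).map_source hx)))
    have h4 : (k ∘ chartAt H x) x = chartAt E' (h x) (h x) := by
      change _ = k (chartAt H (h.symm (h x)) (h.symm (h x)))
      rw [h.symm_apply_apply]
      rfl
    rw [← h4] at h3
    refine (h3.comp x h2).congr_of_eventuallyEq ?_
    filter_upwards [chart_source_mem_nhds H x] with y hy
    change h y = h.symm.symm ((chartAt H (h.symm (h x))).symm (k.symm (k (chartAt H x y))))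
    rw [k.symm_apply_apply, h.symm_apply_apply, (chartAt H x).left_inv hy]
    rfl
  · intro y
    have h1 := contMDiffOn_chart (I := 𝓘(ℝ, E')) (n := ∞) (x := y)
    have h2 := h1.contMDiffAt (chart_source_mem_nhds E' y)
    have h3 := hfrom _ (chart_mem_atlas H (h.symm y))
    have h5 : chartAt E' y y = k (chartAt H (h.symm y) (h.symm y)) := rfl
    have h4 := h3.contMDiffAt (x := chartAt E' y y)
      ((((chartAt H (h.symm y)).open_target.preimage k.symm.continuous)).mem_nhds (by
        rw [h5, Set.mem_preimage, k.symm_apply_apply]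
        exact mem_chart_target H _))
    refine (h4.comp y h2).congr_of_eventuallyEq ?_
    filter_upwards [chart_source_mem_nhds E' y] with z hz
    change h.symm z = (chartAt H (h.symm y)).symm (k.symm (k (chartAt H (h.symm y) (h.symm z))))
    have hz' : h.symm z ∈ (chartAt H (h.symm y)).source := by
      have : z ∈ (tr (chartAt H (h.symm y))).source := hz
      simpa [tr] using this
    rw [k.symm_apply_apply, (chartAt H (h.symm y)).left_inv hz']

end Manifolds

/-! ### Smoothness of the coordinates on `Sp(1,1)` -/

section Smoothness

theorem Sp11.mem_chart_source (g A : Sp11) :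
    A ∈ (Sp11.chart g).source ↔ IsUnit (1 + ((g⁻¹ * A : Sp11) : QMat)) := by
  simp only [Sp11.chart, Sp11.chartOne, OpenPartialHomeomorph.trans_source]
  exact ⟨fun h => h.2, fun h => ⟨trivial, h⟩⟩

/-- In the Cayley chart at `g` the inclusion is `X ↦ g · cayley X`, because the Cayley transform is
an involution. -/
theorem contMDiff_Sp11_val :
    ContMDiff 𝓘(ℝ, sp11) 𝓘(ℝ, QMat) ∞ (Subtype.val : Sp11 → QMat) := by
  intro g
  have h1 : ContMDiffAt 𝓘(ℝ, sp11) 𝓘(ℝ, sp11) ∞ (Sp11.chart g) g :=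
    contMDiffOn_chart.contMDiffAt (chart_source_mem_nhds sp11 g)
  have hg : IsUnit (1 + ((g⁻¹ * g : Sp11) : QMat)) :=
    (Sp11.mem_chart_source g g).1 (mem_chart_source sp11 g)
  have hval (A : Sp11) (hA : IsUnit (1 + ((g⁻¹ * A : Sp11) : QMat))) :
      ((Sp11.chart g A : sp11) : QMat) = cayley ((g⁻¹ * A : Sp11) : QMat) :=
    sp11Proj_coe _ (cayley_mem_sp11 (g⁻¹ * A).2 hA)
  have h2 : ContDiffAt ℝ ∞ (fun X : sp11 => (g : QMat) * cayley (X : QMat)) (Sp11.chart g g) := by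
    refine contDiffAt_const.mul (ContDiffAt.comp (g := cayley) _ ?_ sp11.subtypeL.contDiff.contDiffAt)
    refine contDiffOn_cayley.contDiffAt (isOpen_isUnit_one_add.mem_nhds ?_)
    change IsUnit (1 + ((Sp11.chart g g : sp11) : QMat))
    rw [hval g hg]
    exact isUnit_cayley_add_one hg
  refine (h2.contMDiffAt.comp g h1).congr_of_eventuallyEq ?_
  filter_upwards [chart_source_mem_nhds sp11 g] with A hA
  have hA' := (Sp11.mem_chart_source g A).1 hA
  change (A : QMat) = g * cayley ((Sp11.chart g A : sp11) : QMat)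
  rw [hval A hA', cayley_cayley hA']
  change (A : QMat) = ((g * (g⁻¹ * A) : Sp11) : QMat)
  rw [mul_inv_cancel_left]

variable {E H M : Type*} [NormedAddCommGroup E] [NormedSpace ℝ E] [TopologicalSpace H]
  {I : ModelWithCorners ℝ E H} [TopologicalSpace M] [ChartedSpace H M]

/-- The formula of each chart makes sense, and is smooth, on an open set of `M₂(ℍ)`; smoothness into
`Sp(1,1)` can therefore be tested in the ambient algebra. -/
theorem contMDiff_Sp11_of_val {f : M → Sp11}
    (hf : ContMDiff I 𝓘(ℝ, QMat) ∞ fun x => (f x : QMat)) : ContMDiff I 𝓘(ℝ, sp11) ∞ f := by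
  intro x
  rw [contMDiffAt_iff_target]
  refine ⟨(continuous_induced_rng.2 hf.continuous).continuousAt, ?_⟩
  have hg : IsUnit (1 + (((f x)⁻¹ * f x : Sp11) : QMat)) :=
    (Sp11.mem_chart_source (f x) (f x)).1 (mem_chart_source sp11 (f x))
  have h2 : ContDiffAt ℝ ∞ (fun X : QMat => sp11Proj (cayley (((f x)⁻¹ : Sp11) * X))) (f x) := by
    refine sp11Proj.contDiff.contDiffAt.comp _ (ContDiffAt.comp (g := cayley) _ ?_
      (contDiffAt_const.mul contDiffAt_id))
    exact contDiffOn_cayley.contDiffAt (isOpen_isUnit_one_add.mem_nhds hg)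
  exact ContMDiffAt.comp (f := fun y => (f y : QMat)) x h2.contMDiffAt (hf x)

theorem contDiff_entry (i j : Fin 2) : ContDiff ℝ ∞ fun X : QMat => X i j :=
  (LinearMap.toContinuousLinearMap (Matrix.entryLinearMap ℝ ℍ[ℝ] i j)).contDiff

theorem contMDiff_Sp11_entry_mul_inv (i j k l : Fin 2) (h : ∀ A : Sp11, (A : QMat) k l ≠ 0) :
    ContMDiff 𝓘(ℝ, sp11) 𝓘(ℝ, ℍ[ℝ]) ∞ fun A : Sp11 => (A : QMat) i j * ((A : QMat) k l)⁻¹ := by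
  intro A
  have h1 : ContDiffAt ℝ ∞ (fun q : ℍ[ℝ] => q⁻¹) ((A : QMat) k l) := by
    have := contDiffAt_ringInverse (n := ∞) ℝ (Units.mk0 _ (h A))
    rwa [Ring.inverse_eq_inv'] at this
  have h2 : ContDiffAt ℝ ∞ (fun X : QMat => X i j * (X k l)⁻¹) A :=
    (contDiff_entry i j).contDiffAt.mul (h1.comp (A : QMat) (contDiff_entry k l).contDiffAt)
  exact h2.contMDiffAt.comp A (contMDiff_Sp11_val A)

theorem contMDiff_coords :
    ContMDiff 𝓘(ℝ, sp11) (𝓘(ℝ, ℍ[ℝ]).prod (𝓡 3)) ∞ Sp11.coords := by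
  refine ContMDiff.prodMk (f := fun A => (Sp11.coords A).1) (g := fun A => (Sp11.coords A).2) ?_ ?_
  · rw [← ContMDiff.subtypeVal_comp_iff]
    exact contMDiff_Sp11_entry_mul_inv 1 0 1 1 Sp11.lower_ne_zero
  · exact (contMDiff_Sp11_entry_mul_inv 0 0 1 1 Sp11.lower_ne_zero).codRestrict_sphere
      fun A => (Sp11.coords A).2.2

theorem contDiff_matrix_of {F : Type*} [NormedAddCommGroup F] [NormedSpace ℝ F]
    {f : F → Fin 2 → Fin 2 → ℍ[ℝ]} (hf : ∀ i j, ContDiff ℝ ∞ fun x => f x i j) :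
    ContDiff ℝ ∞ fun x => (Matrix.of (f x) : QMat) :=
  (LinearMap.toContinuousLinearMap
    (Matrix.ofLinearEquiv ℝ : (Fin 2 → Fin 2 → ℍ[ℝ]) ≃ₗ[ℝ] QMat).toLinearMap).contDiff.comp
    (contDiff_pi.2 fun i => contDiff_pi.2 fun j => hf i j)

theorem contDiff_quaternion_star : ContDiff ℝ ∞ (star : ℍ[ℝ] → ℍ[ℝ]) :=
  (LinearMap.toContinuousLinearMap
    ({ toFun := star, map_add' := star_add, map_smul' := fun r q => Quaternion.star_smul r q } :
      ℍ[ℝ] →ₗ[ℝ] ℍ[ℝ])).contDiff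

theorem contDiffAt_boostMatrix {x w : ℍ[ℝ]} (hx : ‖x‖ < 1) :
    ContDiffAt ℝ ∞ (fun y : ℍ[ℝ] × ℍ[ℝ] => boostMatrix y.1 y.2) (x, w) := by
  have h0 : 0 < 1 - ‖x‖ ^ 2 := by nlinarith [norm_nonneg x]
  have h1 : ContDiffAt ℝ ∞ (fun y : ℍ[ℝ] × ℍ[ℝ] => boostScale y.1) (x, w) := by
    have e : ContDiffAt ℝ ∞ (fun y : ℍ[ℝ] × ℍ[ℝ] => 1 - ‖y.1‖ ^ 2) (x, w) :=
      contDiffAt_const.sub (contDiff_fst.norm_sq ℝ).contDiffAt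
    exact (e.sqrt h0.ne').inv (Real.sqrt_pos.2 h0).ne'
  refine h1.smul (contDiff_matrix_of fun i j => ?_).contDiffAt
  fin_cases i <;> fin_cases j
  · exact contDiff_snd
  · exact contDiff_snd.mul (contDiff_quaternion_star.comp contDiff_fst)
  · exact contDiff_fst
  · exact contDiff_const

theorem contMDiff_boost :
    ContMDiff (𝓘(ℝ, ℍ[ℝ]).prod (𝓡 3)) 𝓘(ℝ, sp11) ∞ boost := by
  refine contMDiff_Sp11_of_val fun t => ?_
  have h1 : ContMDiffAt (𝓘(ℝ, ℍ[ℝ]).prod (𝓡 3)) 𝓘(ℝ, ℍ[ℝ] × ℍ[ℝ]) ∞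
      (fun t : QBall × Sp1 => ((t.1 : ℍ[ℝ]), (t.2 : ℍ[ℝ]))) t :=
    ((contMDiff_subtype_val.comp contMDiff_fst).prodMk_space
      (contMDiff_coe_sphere.comp contMDiff_snd)) t
  exact ContMDiffAt.comp (f := fun t : QBall × Sp1 => ((t.1 : ℍ[ℝ]), (t.2 : ℍ[ℝ]))) t
    (contDiffAt_boostMatrix (QBall.norm_lt t.1)).contMDiffAt h1

theorem contMDiff_mul_scalarSp11 (v : Sp1) :
    ContMDiff 𝓘(ℝ, sp11) 𝓘(ℝ, sp11) ∞ fun A : Sp11 => A * scalarSp11 v := by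
  refine contMDiff_Sp11_of_val ?_
  have h : ContDiff ℝ ∞ fun X : QMat => X * (scalarSp11 v : QMat) := contDiff_id.mul contDiff_const
  exact h.contMDiff.comp contMDiff_Sp11_val

instance : LieGroup (𝓡 3) ∞ Sp1 where
  contMDiff_mul := by
    have h : ContMDiff ((𝓡 3).prod (𝓡 3)) 𝓘(ℝ, ℍ[ℝ]) ∞
        fun p : Sp1 × Sp1 => (p.1 : ℍ[ℝ]) * (p.2 : ℍ[ℝ]) := by
      have h1 : ContMDiff ((𝓡 3).prod (𝓡 3)) 𝓘(ℝ, ℍ[ℝ] × ℍ[ℝ]) ∞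
          (fun t : Sp1 × Sp1 => ((t.1 : ℍ[ℝ]), (t.2 : ℍ[ℝ]))) :=
        (contMDiff_coe_sphere.comp contMDiff_fst).prodMk_space
          (contMDiff_coe_sphere.comp contMDiff_snd)
      have h2 : ContDiff ℝ ∞ fun y : ℍ[ℝ] × ℍ[ℝ] => y.1 * y.2 := contDiff_fst.mul contDiff_snd
      exact h2.contMDiff.comp h1
    exact h.codRestrict_sphere fun p => (p.1 * p.2).2
  contMDiff_inv := by
    have h : ContMDiff (𝓡 3) 𝓘(ℝ, ℍ[ℝ]) ∞ fun u : Sp1 => ((u⁻¹ : Sp1) : ℍ[ℝ]) := by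
      simp only [Sp1.coe_inv]
      exact contDiff_quaternion_star.contMDiff.comp contMDiff_coe_sphere
    exact h.codRestrict_sphere fun u => (u⁻¹).2

end Smoothness

/-! ### Existence of the quotient manifold structure -/

section Models

/-- A linear identification of the model space of `𝔹 × Sp(1)` with `ℝ⁷`. -/
noncomputable def modelEquiv :
    (ℍ[ℝ] × EuclideanSpace ℝ (Fin 3)) ≃L[ℝ] EuclideanSpace ℝ (Fin 7) :=
  ContinuousLinearEquiv.ofFinrankEq (by
    rw [Module.finrank_prod, Quaternion.finrank_eq_four]; simp)

/-- `modelEquiv` as a homeomorphism of models. -/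
noncomputable def modelHomeomorph :
    ModelProd ℍ[ℝ] (EuclideanSpace ℝ (Fin 3)) ≃ₜ EuclideanSpace ℝ (Fin 7) :=
  modelEquiv.toHomeomorph

theorem contMDiff_modelHomeomorph :
    ContMDiff (𝓘(ℝ, ℍ[ℝ]).prod (𝓡 3)) (𝓡 7) ∞ modelHomeomorph := by
  have h : ContMDiff 𝓘(ℝ, ℍ[ℝ] × EuclideanSpace ℝ (Fin 3)) (𝓡 7) ∞ modelEquiv :=
    modelEquiv.contDiff.contMDiff
  rw [modelWithCornersSelf_prod] at h
  exact h

theorem contMDiff_modelHomeomorph_symm :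
    ContMDiff (𝓡 7) (𝓘(ℝ, ℍ[ℝ]).prod (𝓡 3)) ∞ modelHomeomorph.symm := by
  have h : ContMDiff (𝓡 7) 𝓘(ℝ, ℍ[ℝ] × EuclideanSpace ℝ (Fin 3)) ∞ modelEquiv.symm :=
    modelEquiv.symm.contDiff.contMDiff
  rw [modelWithCornersSelf_prod] at h
  exact h

/-- The product structure of `𝔹 × Sp(1)` is carried over by `boostEquiv`, which turns the projection
from `Sp(1,1)` into the smooth map `Sp11.coords`. Surjectivity of the differential comes from smooth
sections through every matrix. -/
theorem exists_isQuotientManifold :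
    ∃ (_ : TopologicalSpace RegMobius) (_ : ChartedSpace (EuclideanSpace ℝ (Fin 7)) RegMobius),
      IsQuotientManifold := by
  let T : TopologicalSpace RegMobius := TopologicalSpace.induced boostEquiv.symm inferInstance
  let e : QBall × Sp1 ≃ₜ RegMobius :=
    (boostEquiv.symm.toHomeomorphOfIsInducing ⟨rfl⟩).symm
  have he (t : QBall × Sp1) : e t = boostEquiv t := rfl
  obtain ⟨C, hC, h1, h2⟩ := exists_chartedSpace_of_homeomorph (I := 𝓘(ℝ, ℍ[ℝ]).prod (𝓡 3)) e
    modelHomeomorph contMDiff_modelHomeomorph contMDiff_modelHomeomorph_symm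
  have hπ : mobiusInvMap = e ∘ Sp11.coords := funext fun A => (boostEquiv_coords A).symm
  have hsmooth : ContMDiff 𝓘(ℝ, sp11) (𝓡 7) ∞ mobiusInvMap := by
    rw [hπ]
    exact h1.comp contMDiff_coords
  refine ⟨T, C, hC, e.t2Space, e.symm.secondCountableTopology, hsmooth, mobiusInvMap_surjective, ?_⟩
  intro A
  -- The boosts alone pass only through matrices with positive real lower right entry. Right
  -- multiplication by the scalar `v` leaves the coordinates unchanged and moves the section through
  -- `A`.
  obtain ⟨v, hv⟩ := exists_eq_boost_mul A
  refine mfderiv_surjective_of_section (s := fun F => boost (e.symm F) * scalarSp11 v) hsmooth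
    ((contMDiff_mul_scalarSp11 v).comp (contMDiff_boost.comp h2)) ?_ ?_
  · intro F
    rw [hπ, Function.comp_apply, coords_mul_scalarSp11, coords_boost, e.apply_symm_apply]
  · rw [hπ, Function.comp_apply, e.symm_apply_apply]
    exact hv.symm

end Models

/-! ### The principal bundle structure -/

/-- The set is the projection to `G` of the closed subset `{(g, x) : g • x ∈ K}` of the compact
space `G × K`. -/
theorem isCompact_setOf_smul_inter_nonempty {G X : Type*} [TopologicalSpace G] [CompactSpace G]
    [TopologicalSpace X] [T2Space X] [SMul G X] (hc : Continuous fun x : G × X => x.1 • x.2)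
    {K : Set X} (hK : IsCompact K) : IsCompact {g : G | (((g • ·) '' K) ∩ K).Nonempty} := by
  have h1 : IsCompact ((Set.univ ×ˢ K) ∩ (fun x : G × X => x.1 • x.2) ⁻¹' K) :=
    (isCompact_univ.prod hK).inter_right (hK.isClosed.preimage hc)
  convert h1.image continuous_fst using 1
  ext g
  constructor
  · rintro ⟨_, ⟨x, hx, rfl⟩, hgx⟩
    exact ⟨(g, x), ⟨⟨trivial, hx⟩, hgx⟩, rfl⟩
  · rintro ⟨⟨_, x⟩, ⟨⟨-, hx⟩, hgx⟩, rfl⟩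
    exact ⟨_, ⟨x, hx, rfl⟩, hgx⟩

section Main

variable [TopologicalSpace RegMobius] [ChartedSpace (EuclideanSpace ℝ (Fin 7)) RegMobius]

/-- The diffeomorphism `𝔹 × Sp(1) → 𝓜(𝔹)`. -/
noncomputable def boostDiffeomorph (h : IsQuotientManifold) :
    Diffeomorph (𝓘(ℝ, ℍ[ℝ]).prod (𝓡 3)) (𝓡 7) (QBall × Sp1) RegMobius ∞ where
  toEquiv := boostEquiv
  contMDiff_toFun := h.submersion.contMDiff.comp contMDiff_boost
  contMDiff_invFun := by
    have := h.manifold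
    -- The only use of surjectivity of the differential of `A ↦ 𝓕_{A⁻¹}`: it lets smoothness of the
    -- inverse be checked upstairs, where the inverse becomes `Sp11.coords`.
    refine contMDiff_of_comp_submersion h.submersion ?_
    have e : boostEquiv.symm ∘ mobiusInvMap = Sp11.coords :=
      funext boostEquiv_symm_mobiusInvMap
    rw [e]
    exact contMDiff_coords

/-- `𝓜(𝔹)₀` is homeomorphic to `Sp(1)`. -/
noncomputable def isotropyHomeomorph (h : IsQuotientManifold) : Sp1 ≃ₜ RegMobiusZero where
  toEquiv := isotropyEquiv.toEquiv
  continuous_toFun := by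
    refine continuous_induced_rng.2 ?_
    have e : (Subtype.val ∘ isotropyEquiv.toEquiv.toFun : Sp1 → RegMobius)
        = fun w => boostDiffeomorph h (0, w) := funext fun w => (boostEquiv_zero_left w).symm
    change Continuous (Subtype.val ∘ isotropyEquiv.toEquiv.toFun : Sp1 → RegMobius)
    rw [e]
    exact (boostDiffeomorph h).continuous.comp (by fun_prop)
  continuous_invFun := by
    have e : (isotropyEquiv.toEquiv.invFun : RegMobiusZero → Sp1)
        = fun F => ((boostDiffeomorph h).symm F.1).2 := by
      funext F
      obtain ⟨u, rfl⟩ := isotropyEquiv.surjective F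
      have h1 : (boostDiffeomorph h).symm (isotropyEquiv u).1 = (0, u) := by
        rw [← boostEquiv_zero_left]
        exact boostEquiv.symm_apply_apply _
      rw [h1]
      exact isotropyEquiv.symm_apply_apply u
    rw [e]
    exact continuous_snd.comp ((boostDiffeomorph h).symm.continuous.comp continuous_subtype_val)

/-- Under the diffeomorphism with `𝔹 × Sp(1)` the inclusion becomes `u ↦ (0, u)`. In product charts
this is linear, with the model `ℍ` of the ball as complement. -/
theorem isImmersion_isotropy_val (h : IsQuotientManifold)
    [ChartedSpace (EuclideanSpace ℝ (Fin 3)) RegMobiusZero] [IsManifold (𝓡 3) ∞ RegMobiusZero]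
    (h1 : ContMDiff (𝓡 3) (𝓡 3) ∞ (isotropyHomeomorph h))
    (h2 : ContMDiff (𝓡 3) (𝓡 3) ∞ (isotropyHomeomorph h).symm) :
    Manifold.IsImmersion (𝓡 3) (𝓡 7) ∞ (Subtype.val : RegMobiusZero → RegMobius) := by
  have := h.manifold
  refine ⟨ℍ[ℝ], inferInstance, inferInstance, fun F => ?_⟩
  set ρ := isotropyHomeomorph h with hρ
  set Φ := boostDiffeomorph h with hΦ
  let c := chartAt (EuclideanSpace ℝ (Fin 3)) (ρ.symm F)
  let b := chartAt ℍ[ℝ] (0 : QBall)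
  have hval (u : Sp1) : (ρ u).1 = Φ (0, u) := (boostEquiv_zero_left u).symm
  -- The chart of an open subset of `ℍ` is the inclusion, so the slice sits at the zero vector, as
  -- the linear normal form of an immersion requires.
  have hb : b 0 = 0 := rfl
  have hbs : (0 : QBall) ∈ b.source := mem_chart_source _ _
  let p : OpenPartialHomeomorph (QBall × Sp1) (ModelProd ℍ[ℝ] (EuclideanSpace ℝ (Fin 3))) :=
    b.prod c
  have hp : p = chartAt (ModelProd ℍ[ℝ] (EuclideanSpace ℝ (Fin 3))) ((0 : QBall), ρ.symm F) := rfl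
  have hcF : ρ.symm F ∈ c.source := mem_chart_source _ _
  let dom : OpenPartialHomeomorph RegMobiusZero (EuclideanSpace ℝ (Fin 3)) :=
    ρ.symm.toOpenPartialHomeomorph.trans c
  let cod : OpenPartialHomeomorph RegMobius (EuclideanSpace ℝ (Fin 7)) :=
    Φ.symm.toHomeomorph.toOpenPartialHomeomorph.trans (p.trans modelHomeomorph.toOpenPartialHomeomorph)
  have hsymm (G : RegMobiusZero) : Φ.symm G.1 = (0, ρ.symm G) := by
    obtain ⟨u, rfl⟩ := ρ.surjective G
    rw [hval, Φ.symm_apply_apply, ρ.symm_apply_apply]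
  have hds (G : RegMobiusZero) (hG : G ∈ dom.source) : ρ.symm G ∈ c.source := by
    simpa [dom] using hG
  have hmem (G : RegMobiusZero) (hG : ρ.symm G ∈ c.source) : G.1 ∈ cod.source := by
    have : Φ.symm G.1 ∈ p.source := by
      rw [hsymm]
      exact ⟨hbs, hG⟩
    simpa [cod] using this
  -- The normal form `v ↦ (v, 0)` puts the complement second, whereas the ball is the first factor
  -- of the model; hence the exchange of factors.
  refine Manifold.IsImmersionAtOfComplement.mk_of_charts
    ((ContinuousLinearEquiv.prodComm ℝ _ _).trans modelEquiv) dom cod ?_ ?_ ?_ ?_ ?_ ?_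
  · simpa [dom] using hcF
  · exact hmem F (by simpa [dom] using hcF)
  · refine dom.mem_maximalAtlas_of_contMDiffOn ?_ ?_
    · exact contMDiffOn_chart.comp h2.contMDiffOn fun x hx => hds x hx
    · exact h1.comp_contMDiffOn (contMDiffOn_chart_symm.mono fun x hx => by simpa [dom] using hx)
  · refine cod.mem_maximalAtlas_of_contMDiffOn ?_ ?_
    · exact contMDiff_modelHomeomorph.comp_contMDiffOn
        ((contMDiffOn_chart (x := ((0 : QBall), ρ.symm F))).comp
          Φ.symm.contMDiff.contMDiffOn fun x hx => by simpa [cod, hp] using hx)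
    · exact Φ.contMDiff.comp_contMDiffOn
        ((contMDiffOn_chart_symm (x := ((0 : QBall), ρ.symm F))).comp
          contMDiff_modelHomeomorph_symm.contMDiffOn fun x hx => by simpa [cod, hp] using hx)
  · exact fun x hx => hmem x (hds x hx)
  · intro v hv
    have hv' : v ∈ c.target := by simpa [dom] using hv
    change modelEquiv (p (Φ.symm (ρ (c.symm v)).1)) = modelEquiv (0, v)
    rw [hsymm, ρ.symm_apply_apply]
    change modelEquiv (b 0, c (c.symm v)) = _
    rw [hb, c.right_inv hv']

end Main

theorem mainTheorem7 :
    (∀ F : RegMobius, Function.Bijective F) ∧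
    (∃ (_ : TopologicalSpace RegMobius) (_ : ChartedSpace (EuclideanSpace ℝ (Fin 7)) RegMobius),
      IsQuotientManifold) ∧
    ∀ [TopologicalSpace RegMobius] [ChartedSpace (EuclideanSpace ℝ (Fin 7)) RegMobius],
      IsQuotientManifold →
      ∃ _ : ChartedSpace (EuclideanSpace ℝ (Fin 3)) RegMobiusZero,
        Manifold.IsSmoothEmbedding (𝓡 3) (𝓡 7) ∞ (Subtype.val : RegMobiusZero → RegMobius) ∧
        (∃ ρ : Sp1 ≃* RegMobiusZero,
          (∀ (u : Sp1) (q : QBall), ((ρ u).1 q : ℍ[ℝ]) = q * ((u⁻¹ : Sp1) : ℍ[ℝ])) ∧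
          ContMDiff (𝓡 3) (𝓡 3) ∞ ρ ∧ ContMDiff (𝓡 3) (𝓡 3) ∞ ρ.symm) ∧
        IsLeftPrincipalBundle (𝓡 3) (𝓡 7) 𝓘(ℝ, ℍ[ℝ]) RegMobiusZero inverseOrbit ∧
        IsGloballyTrivial (𝓡 3) (𝓡 7) 𝓘(ℝ, ℍ[ℝ]) RegMobiusZero inverseOrbit := by
  refine ⟨RegMobius.bijective, exists_isQuotientManifold, ?_⟩
  intro _ _ h
  -- The isotropy group receives the smooth structure of `Sp(1)`. Its topology is already the
  -- subspace topology, so the inclusion is an embedding as soon as it is an immersion.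
  obtain ⟨C, hC, h1, h2⟩ := exists_chartedSpace_of_homeomorph (I := 𝓡 3) (isotropyHomeomorph h)
    (Homeomorph.refl (EuclideanSpace ℝ (Fin 3))) contMDiff_id contMDiff_id
  have := h.manifold
  have := h.hausdorff
  have hρ1 : ContMDiff (𝓡 3) (𝓡 3) ∞ isotropyEquiv := h1
  have hρ2 : ContMDiff (𝓡 3) (𝓡 3) ∞ isotropyEquiv.symm := h2
  set Φ := boostDiffeomorph h with hΦ
  have hΦt (t : QBall × Sp1) : Φ t = boostEquiv t := rfl
  let R : Diffeomorph (𝓡 3) (𝓡 3) RegMobiusZero Sp1 ∞ :=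
    ⟨isotropyEquiv.symm.toEquiv, hρ2, hρ1⟩
  -- The global trivialization: the boost coordinates with `Sp(1)` replaced by the isotropy group
  -- through the isomorphism `u ↦ (q ↦ q u⁻¹)`.
  let Ψ : Diffeomorph (𝓘(ℝ, ℍ[ℝ]).prod (𝓡 3)) (𝓡 7) (QBall × RegMobiusZero) RegMobius ∞ :=
    ((Diffeomorph.refl 𝓘(ℝ, ℍ[ℝ]) QBall ∞).prodCongr R).trans Φ
  have hΨ (x : QBall) (F : RegMobiusZero) : Ψ (x, F) = boostEquiv (x, isotropyEquiv.symm F) := rfl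
  have hfib (x : QBall) (g : RegMobiusZero) : inverseOrbit (Ψ (x, g)) = x := by
    rw [hΨ, inverseOrbit_boostEquiv]
  have hequi (x : QBall) (g k : RegMobiusZero) : Ψ (x, g * k) = g • Ψ (x, k) := by
    rw [hΨ, hΨ, map_mul, ← isotropyEquiv_smul, isotropyEquiv.apply_symm_apply]
  have hcoord (p : RegMobius) : ∃ x F, p = Ψ (x, F) :=
    ⟨(Ψ.symm p).1, (Ψ.symm p).2, (Ψ.apply_symm_apply p).symm⟩
  have horb : inverseOrbit = Prod.fst ∘ Ψ.symm := by
    funext p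
    obtain ⟨x, F, rfl⟩ := hcoord p
    rw [hfib, Function.comp_apply, Ψ.symm_apply_apply]
  have horbs : ContMDiff (𝓡 7) 𝓘(ℝ, ℍ[ℝ]) ∞ inverseOrbit := by
    rw [horb]
    exact contMDiff_fst.comp Ψ.symm.contMDiff
  have hact : ContMDiff ((𝓡 3).prod (𝓡 7)) (𝓡 7) ∞
      fun x : RegMobiusZero × RegMobius => x.1 • x.2 := by
    -- In boost coordinates the action is multiplication in the Lie group `Sp(1)` on the second
    -- factor, from which its smoothness follows.
    have e : (fun x : RegMobiusZero × RegMobius => x.1 • x.2) = fun x =>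
        Φ ((Φ.symm x.2).1, isotropyEquiv.symm x.1 * (Φ.symm x.2).2) := by
      funext ⟨g, p⟩
      obtain ⟨⟨x, w⟩, rfl⟩ : ∃ t, p = Φ t := ⟨Φ.symm p, (Φ.apply_symm_apply p).symm⟩
      change g • Φ (x, w) = Φ ((Φ.symm (Φ (x, w))).1, _ * (Φ.symm (Φ (x, w))).2)
      rw [Φ.symm_apply_apply, hΦt, hΦt, ← isotropyEquiv_smul, isotropyEquiv.apply_symm_apply]
    rw [e]
    exact Φ.contMDiff.comp ((contMDiff_fst.comp (Φ.symm.contMDiff.comp contMDiff_snd)).prodMk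
      ((hρ2.comp contMDiff_fst).mul
        (contMDiff_snd.comp (Φ.symm.contMDiff.comp contMDiff_snd))))
  have hlie : LieGroup (𝓡 3) ∞ RegMobiusZero :=
    { hC with
      contMDiff_mul := by
        have e : (fun p : RegMobiusZero × RegMobiusZero => p.1 * p.2) = fun p =>
            isotropyEquiv (isotropyEquiv.symm p.1 * isotropyEquiv.symm p.2) := by
          funext p
          rw [map_mul, isotropyEquiv.apply_symm_apply, isotropyEquiv.apply_symm_apply]
        rw [e]
        exact hρ1.comp ((hρ2.comp contMDiff_fst).mul (hρ2.comp contMDiff_snd))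
      contMDiff_inv := by
        have e : (fun p : RegMobiusZero => p⁻¹) = fun p =>
            isotropyEquiv (isotropyEquiv.symm p)⁻¹ := by
          funext p
          rw [map_inv, isotropyEquiv.apply_symm_apply]
        rw [e]
        exact hρ1.comp hρ2.inv }
  have : CompactSpace RegMobiusZero := (isotropyHomeomorph h).compactSpace
  refine ⟨C, ⟨isImmersion_isotropy_val h h1 h2, Topology.IsEmbedding.subtypeVal⟩,
    ⟨isotropyEquiv, fun u q => rightMul_apply u⁻¹ q, hρ1, hρ2⟩, ?_, ⟨Ψ, hfib, hequi⟩⟩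
  refine
    { manifold_total := h.manifold
      manifold_base := inferInstance
      lieGroup := hlie
      submersion := ⟨horbs, fun x => ⟨Ψ (x, 1), hfib x 1⟩, fun p => ?_⟩
      smooth_action := hact
      free := fun g p hgp => ?_
      proper := fun K hK => isCompact_setOf_smul_inter_nonempty hact.continuous hK
      fibers := fun p p' => ?_
      locally_trivial := fun b => ⟨Set.univ, isOpen_univ, trivial,
        Ψ.toHomeomorph.toOpenPartialHomeomorph, by simp, by simp, Ψ.contMDiff.contMDiffOn,
        Ψ.symm.contMDiff.contMDiffOn, fun x _ g => hfib x g, fun x _ g k => hequi x g k⟩ }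
  · obtain ⟨x, F, rfl⟩ := hcoord p
    -- The section with constant second coordinate `F` passes through the given point.
    refine mfderiv_surjective_of_section (s := fun y => Ψ (y, F)) horbs
      (Ψ.contMDiff.comp (contMDiff_id.prodMk contMDiff_const)) (fun y => hfib y F) ?_
    rw [hfib]
  · obtain ⟨x, F, rfl⟩ := hcoord p
    rw [← hequi] at hgp
    exact mul_eq_right.1 (Prod.ext_iff.1 (Ψ.injective hgp)).2
  · obtain ⟨x, F, rfl⟩ := hcoord p
    obtain ⟨x', F', rfl⟩ := hcoord p'
    rw [hfib, hfib]
    constructor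
    · rintro rfl
      exact ⟨F' * F⁻¹, by rw [← hequi, inv_mul_cancel_right]⟩
    · rintro ⟨g, hg⟩
      rw [← hequi] at hg
      exact (Prod.ext_iff.1 (Ψ.injective hg)).1
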